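/- **Proposition (Basic properties of the canonical model).** *Definitions.* A Boolean algebra is $\sigma$-complete if every sequence in it has a join (hence also a meet); a $\sigma$-homomorphism is a Boolean homomorphism preserving countable joins and meets. An abstract probability space $X=(B_X,\mu_X)$ is a $\sigma$-complete Boolean algebra with a countably additive $\mu_X\colon B_X\to[0,1]$, $\mu_X(0)=0$, $\mu_X(1)=1$; it is a *probability algebra* if $\mu_X(E)>0$ for all $E\neq 0$. A morphism $T\colon X\to Y$ of probability algebras is a $\sigma$-homomorphism $T^*\colon B_Y\to B_X$ (note the reversed direction) with $\mu_X(T^*E)=\mu_Y(E)$ for all $E\in B_Y$; this gives the category $\mathbf{ProbAlg}$. Objects of $\mathbf{CHPrb}$ are compact Hausdorff spaces $K$ with a probability measure $\mu_K$ on the Baire $\sigma$-algebra (the one generated by the continuous functions $K\to\mathbb C$; such measures are automatically Radon); morphisms are continuous measure-preserving maps. The casting functor $\mathrm{Cast}\colon\mathbf{CHPrb}\to\mathbf{ProbAlg}$ sends $K$ to its Baire $\sigma$-algebra modulo $\mu_K$-null sets, with the induced measure, and sends a map $T$ to the homomorphism induced by $E\mapsto T^{-1}(E)$. For a probability algebra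 $X$, let $L^\infty(X)$ be the set of $\sigma$-homomorphisms $f\colon \mathrm{Borel}(\mathbb C)\to B_X$ that are bounded, i.e. $f(\{|z|\le M\})=1$ for some $M\geq 0$. It is a commutative unital $C^*$-algebra, with norm the infimum of such $M$. The sum and product of $f,g$ are obtained from the unique $\sigma$-homomorphism $(f,g)\colon \mathrm{Borel}(\mathbb C^2)\to B_X$ with marginals $f$ and $g$, by composing it with the preimage map under addition, respectively multiplication, $\mathbb C^2\to\mathbb C$; the involution and multiplication by a scalar are obtained in the same way from the corresponding maps $\mathbb C\to\mathbb C$. It carries the state $\tau_X(f)=\int_{\mathbb C} z\,d(\mu_X\circ f)(z)$. A morphism $T\colon X\to Y$ induces the unital $*$-homomorphism $L^\infty(T)\colon L^\infty(Y)\to L^\infty(X)$, $f\mapsto T^*\circ f$, which preserves the states. The *canonical model functor* $\mathrm{Stone}\colon\mathbf{ProbAlg}\to\mathbf{CHPrb}$ sends $X$ to the Gelfand spectrum of $L^\infty(X)$ with the unique Baire probability measure $\mu$ satisfying $\int \hat f\,d\mu=\tau_X(f)$ for all $f\in L^\infty(X)$, where $\hat f$ is the Gelfand transform, and sends $T$ to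 the map $\chi\mapsto\chi\circ L^\infty(T)$. *Statement.* (i) The functor $\mathrm{Cast}\circ\mathrm{Stone}\colon\mathbf{ProbAlg}\to\mathbf{ProbAlg}$ is naturally isomorphic to the identity functor. Moreover $\mathrm{Stone}$ is full and faithful. (ii) For every probability algebra $X$, the space $\mathrm{Stone}(X)$ has the *strong Lusin property*: every almost-everywhere equivalence class in $L^\infty(\mathrm{Stone}(X))$ (with respect to the Baire measure of $\mathrm{Stone}(X)$) contains exactly one continuous function. Consequently $g\mapsto[g]$ is an isometric linear bijection $C(\mathrm{Stone}(X))\to L^\infty(\mathrm{Stone}(X))$ (and it respects products and complex conjugation, since these are pointwise on both sides). -/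

import Mathlib

universe u v w

noncomputable section

namespace CanonicalModel

open Set MeasureTheory CategoryTheory
open scoped ENNReal

/-! ### Countably complete Boolean algebras and their morphisms -/

/-- A Boolean algebra is `σ`-complete if every sequence has a join. By complementation every
sequence then has a meet. -/
class SigmaComplete (B : Type u) [BooleanAlgebra B] : Prop where
  exists_isLUB : ∀ E : ℕ → B, ∃ a, IsLUB (range E) a

/-- Morphisms of `σ`-complete Boolean algebras: Boolean homomorphisms which preserve joins of
sequences (hence also meets of sequences, by complementation, see `SigmaHom.map_isGLB`). -/
structure SigmaHom (A : Type u) (B : Type v) [BooleanAlgebra A] [BooleanAlgebra B] extends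
    BoundedLatticeHom A B where
  map_isLUB' : ∀ (E : ℕ → A) (a : A), IsLUB (range E) a →
    IsLUB (range fun n => toFun (E n)) (toFun a)

namespace SigmaHom

variable {A : Type u} {B : Type v} {C : Type w} [BooleanAlgebra A] [BooleanAlgebra B]
  [BooleanAlgebra C]

instance : FunLike (SigmaHom A B) A B where
  coe f := f.toFun
  coe_injective f g h := by
    obtain ⟨f, hf⟩ := f
    obtain ⟨g, hg⟩ := g
    congr
    exact DFunLike.coe_injective h

instance : BoundedLatticeHomClass (SigmaHom A B) A B where
  map_sup f := f.map_sup'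
  map_inf f := f.map_inf'
  map_top f := f.map_top'
  map_bot f := f.map_bot'

@[ext]
theorem ext {f g : SigmaHom A B} (h : ∀ a, f a = g a) : f = g := DFunLike.ext _ _ h

theorem map_isLUB (f : SigmaHom A B) {E : ℕ → A} {a : A} (h : IsLUB (range E) a) :
    IsLUB (range fun n => f (E n)) (f a) := f.map_isLUB' E a h

theorem isGLB_iff_compl (E : ℕ → A) (a : A) :
    IsGLB (range E) a ↔ IsLUB (range fun n => (E n)ᶜ) aᶜ := by
  simp only [isLUB_iff_le_iff, isGLB_iff_le_iff, mem_upperBounds, mem_lowerBounds,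
    forall_mem_range]
  constructor
  · intro h b
    have h1 := h bᶜ
    rw [compl_le_iff_compl_le, h1]
    exact forall_congr' fun n => by rw [compl_le_iff_compl_le]
  · intro h b
    have h1 := h bᶜ
    rw [compl_le_compl_iff_le] at h1
    rw [h1]
    exact forall_congr' fun n => by rw [compl_le_compl_iff_le]

theorem map_isGLB (f : SigmaHom A B) {E : ℕ → A} {a : A} (h : IsGLB (range E) a) :
    IsGLB (range fun n => f (E n)) (f a) := by
  rw [isGLB_iff_compl] at h ⊢
  simpa only [map_compl'] using f.map_isLUB h

/-- The identity morphism. -/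
def id (A : Type u) [BooleanAlgebra A] : SigmaHom A A where
  toBoundedLatticeHom := BoundedLatticeHom.id A
  map_isLUB' _ _ h := h

/-- Composition of morphisms. -/
def comp (g : SigmaHom B C) (f : SigmaHom A B) : SigmaHom A C where
  toBoundedLatticeHom := g.toBoundedLatticeHom.comp f.toBoundedLatticeHom
  map_isLUB' _ _ h := g.map_isLUB (f.map_isLUB h)

@[simp] theorem id_apply (a : A) : SigmaHom.id A a = a := rfl

@[simp] theorem comp_apply (g : SigmaHom B C) (f : SigmaHom A B) (a : A) :
    g.comp f a = g (f a) := rfl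

end SigmaHom

/-- The `σ`-complete Boolean algebra of measurable subsets of a measurable space. -/
abbrev MSets (Z : Type u) [MeasurableSpace Z] : Type u := {s : Set Z // MeasurableSet s}

section MSets

variable {Z : Type u} {W : Type v} [MeasurableSpace Z] [MeasurableSpace W]

theorem isLUB_mSets_iff (E : ℕ → MSets Z) (a : MSets Z) :
    IsLUB (range E) a ↔ (a : Set Z) = ⋃ n, (E n : Set Z) := by
  have key : IsLUB (range E) ⟨⋃ n, (E n : Set Z), MeasurableSet.iUnion fun n => (E n).2⟩ := by
    constructor
    · rintro _ ⟨n, rfl⟩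
      exact subset_iUnion (fun n => (E n : Set Z)) n
    · intro b hb
      exact iUnion_subset fun n => hb ⟨n, rfl⟩
  constructor
  · intro h
    rw [h.unique key]
  · intro h
    have : a = ⟨⋃ n, (E n : Set Z), MeasurableSet.iUnion fun n => (E n).2⟩ := Subtype.ext h
    rw [this]
    exact key

instance : SigmaComplete (MSets Z) where
  exists_isLUB E := ⟨⟨⋃ n, (E n : Set Z), MeasurableSet.iUnion fun n => (E n).2⟩,
    (isLUB_mSets_iff _ _).2 rfl⟩

/-- Pullback of measurable sets along a measurable map. -/
def preimageHom (F : Z → W) (hF : Measurable F) : SigmaHom (MSets W) (MSets Z) where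
  toFun s := ⟨F ⁻¹' s, hF s.2⟩
  map_sup' _ _ := rfl
  map_inf' _ _ := rfl
  map_top' := rfl
  map_bot' := rfl
  map_isLUB' E a h := by
    rw [isLUB_mSets_iff] at h ⊢
    simp [h]

@[simp] theorem coe_preimageHom (F : Z → W) (hF : Measurable F) (s : MSets W) :
    (preimageHom F hF s : Set Z) = F ⁻¹' s := rfl

/-- Two morphisms on measurable sets agree if they agree on a generating family. -/
theorem mSets_hom_ext {B : Type w} [BooleanAlgebra B] {S : Set (Set Z)}
    (hS : ‹MeasurableSpace Z› = MeasurableSpace.generateFrom S) {f g : SigmaHom (MSets Z) B}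
    (h : ∀ s ∈ S, ∀ hm : MeasurableSet s, f ⟨s, hm⟩ = g ⟨s, hm⟩) : f = g := by
  have : ∀ s : Set Z, ∀ h : MeasurableSet s, f ⟨s, h⟩ = g ⟨s, h⟩ := by
    intro s hm
    have hm' := hm
    revert hm
    rw [hS] at hm'
    induction s, hm' using MeasurableSpace.generateFrom_induction with
    | hC t ht _ => exact fun hm => h t ht hm
    | empty =>
      intro hm
      have : (⟨∅, hm⟩ : MSets Z) = ⊥ := rfl
      rw [this, BotHomClass.map_bot, BotHomClass.map_bot]
    | compl t ht ih =>
      intro hm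
      have ht' : MeasurableSet t := by rw [hS]; exact ht
      have : (⟨tᶜ, hm⟩ : MSets Z) = ⟨t, ht'⟩ᶜ := rfl
      rw [this, map_compl', map_compl', ih]
    | iUnion t ht ih =>
      intro hm
      have ht' : ∀ n, MeasurableSet (t n) := fun n => by rw [hS]; exact ht n
      have hl : IsLUB (range fun n => (⟨t n, ht' n⟩ : MSets Z)) ⟨⋃ n, t n, hm⟩ :=
        (isLUB_mSets_iff _ _).2 rfl
      have h1 := f.map_isLUB hl
      have h2 := g.map_isLUB hl
      simp only [fun n => ih n (ht' n)] at h1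
      exact h1.unique h2
  ext ⟨s, hs⟩
  exact this s hs

end MSets

/-! ### A concrete presentation of a `σ`-complete Boolean algebra

Every `σ`-complete Boolean algebra is a quotient of a `σ`-algebra of sets. This is only used to
show that the operations on abstract functions below are well defined. -/

section Presentation

variable {B : Type u} [BooleanAlgebra B]

theorem inf_isLUB {E : ℕ → B} {a : B} (h : IsLUB (range E) a) (c : B) (hc : ∀ n, Disjoint c (E n)) :
    Disjoint c a := by
  rw [disjoint_comm, ← le_compl_iff_disjoint_right]
  refine h.2 ?_
  rintro _ ⟨n, rfl⟩
  rw [le_compl_iff_disjoint_right]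
  exact (hc n).symm

variable (B) in
/-- The prime ideals of `B`. -/
def Pts : Type u := {I : Order.Ideal B // I.IsPrime}

/-- The set of prime ideals that omit `a`. -/
def basicSet (a : B) : Set (Pts B) := {P | a ∉ P.1}

theorem basicSet_bot : basicSet (⊥ : B) = ∅ := by
  ext P; simp [basicSet]

theorem basicSet_top : basicSet (⊤ : B) = univ := by
  ext P
  simp only [basicSet, mem_ofPred_eq, mem_univ, iff_true]
  exact fun h => P.2.toIsProper.top_notMem h

theorem basicSet_compl (a : B) : basicSet aᶜ = (basicSet a)ᶜ := by
  ext P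
  simp only [basicSet, mem_ofPred_eq, mem_compl_iff, not_not]
  constructor
  · intro h
    exact P.2.mem_or_compl_mem.resolve_right h
  · intro h h'
    have := P.1.sup_mem h h'
    rw [sup_compl_eq_top] at this
    exact P.2.toIsProper.top_notMem this

theorem basicSet_sup (a b : B) : basicSet (a ⊔ b) = basicSet a ∪ basicSet b := by
  ext P
  simp only [basicSet, mem_ofPred_eq, mem_union, Order.Ideal.sup_mem_iff]
  tauto

theorem basicSet_mono {a b : B} (h : a ≤ b) : basicSet a ⊆ basicSet b :=
  fun P hP hb => hP (P.1.lower h hb)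

/-- Subsets of countable unions of sets `[⋁ E] \ ⋃ [E n]`. -/
def Negl (s : Set (Pts B)) : Prop :=
  ∃ (E : ℕ → ℕ → B) (a : ℕ → B), (∀ n, IsLUB (range (E n)) (a n)) ∧
    s ⊆ ⋃ n, (basicSet (a n) \ ⋃ k, basicSet (E n k))

theorem Negl.mono {s t : Set (Pts B)} (h : Negl t) (hs : s ⊆ t) : Negl s := by
  obtain ⟨E, a, h1, h2⟩ := h
  exact ⟨E, a, h1, hs.trans h2⟩

theorem Negl.iUnion {s : ℕ → Set (Pts B)} (h : ∀ n, Negl (s n)) : Negl (⋃ n, s n) := by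
  choose E a h1 h2 using h
  refine ⟨fun n => E n.unpair.1 n.unpair.2, fun n => a n.unpair.1 n.unpair.2,
    fun n => h1 _ _, ?_⟩
  refine iUnion_subset fun n => (h2 n).trans (iUnion_subset fun m => ?_)
  refine subset_iUnion_of_subset (Nat.pair n m) ?_
  simp

theorem Negl.empty : Negl (∅ : Set (Pts B)) :=
  ⟨fun _ _ => ⊥, fun _ => ⊥, fun _ => by simp, by simp⟩

theorem Negl.union {s t : Set (Pts B)} (hs : Negl s) (ht : Negl t) : Negl (s ∪ t) := by
  refine (Negl.iUnion (s := fun n => if n = 0 then s else t) ?_).mono ?_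
  · intro n
    split_ifs <;> assumption
  · rintro x (hx | hx)
    · exact mem_iUnion.2 ⟨0, by simpa using hx⟩
    · exact mem_iUnion.2 ⟨1, by simpa using hx⟩

/-- Step in the construction of a prime ideal which respects countably many joins. -/
theorem exists_step {E : ℕ → B} {a c : B} (h : IsLUB (range E) a) (hc : c ≠ ⊥) :
    ∃ d, d ≠ ⊥ ∧ d ≤ c ∧ (d ≤ aᶜ ∨ ∃ k, d ≤ E k) := by
  by_cases h0 : ∀ k, Disjoint c (E k)
  · exact ⟨c, hc, le_rfl, Or.inl (le_compl_iff_disjoint_right.2 (inf_isLUB h c h0))⟩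
  · push Not at h0
    obtain ⟨k, hk⟩ := h0
    exact ⟨c ⊓ E k, fun h => hk (disjoint_iff.2 h), inf_le_left, Or.inr ⟨k, inf_le_right⟩⟩

theorem eq_bot_of_negl {c : B} (h : Negl (basicSet c)) : c = ⊥ := by
  by_contra hc
  obtain ⟨E, a, h1, h2⟩ := h
  choose d hd0 hdc hd using fun (n : ℕ) (c : {c : B // c ≠ ⊥}) => exists_step (h1 n) c.2
  let x : ℕ → {c : B // c ≠ ⊥} := fun n => Nat.rec ⟨c, hc⟩ (fun n c => ⟨d n c, hd0 n c⟩) n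
  have hx : ∀ n, (x (n + 1)).1 = d n (x n) := fun n => rfl
  have hanti : Antitone fun n => (x n).1 := antitone_nat_of_succ_le fun n => hdc n (x n)
  let F : Order.PFilter B := Order.IsPFilter.toPFilter (F := {y | ∃ n, (x n).1 ≤ y}) <| by
    refine Order.IsPFilter.of_def ⟨c, 0, le_rfl⟩ ?_ ?_
    · rintro y ⟨n, hn⟩ z ⟨m, hm⟩
      exact ⟨(x (max n m)).1, ⟨_, le_rfl⟩, (hanti (le_max_left n m)).trans hn,
        (hanti (le_max_right n m)).trans hm⟩
    · rintro y z hyz ⟨n, hn⟩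
      exact ⟨n, hn.trans hyz⟩
  have hF : ∀ y, y ∈ F ↔ ∃ n, (x n).1 ≤ y := fun y => Iff.rfl
  obtain ⟨J, hJ, -, hdis⟩ := DistribLattice.prime_ideal_of_disjoint_filter_ideal (F := F)
    (I := Order.Ideal.principal (⊥ : B)) <| by
      rw [Set.disjoint_left]
      rintro y ⟨n, hn⟩ hy
      have : y ≤ ⊥ := hy
      exact (x n).2 (le_bot_iff.1 (hn.trans this))
  have hxJ : ∀ n, (x n).1 ∉ J := fun n => Set.disjoint_left.1 hdis ((hF _).2 ⟨n, le_rfl⟩)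
  have hmem : (⟨J, hJ⟩ : Pts B) ∈ basicSet c := hxJ 0
  obtain ⟨n, hn1, hn2⟩ := mem_iUnion.1 (h2 hmem)
  rcases hd n (x n) with h | ⟨k, hk⟩
  · have := basicSet_mono h (hxJ (n + 1) : (⟨J, hJ⟩ : Pts B) ∈ _)
    rw [basicSet_compl] at this
    exact this hn1
  · exact hn2 (mem_iUnion.2 ⟨k, basicSet_mono hk (hxJ (n + 1) : (⟨J, hJ⟩ : Pts B) ∈ _)⟩)

/-- `s` and `[b]` differ by a negligible set. -/
def Near (s : Set (Pts B)) (b : B) : Prop := Negl (s \ basicSet b) ∧ Negl (basicSet b \ s)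

theorem near_basicSet (b : B) : Near (basicSet b) b := by
  simp [Near, Negl.empty]

theorem Near.le {s t : Set (Pts B)} {b c : B} (hs : Near s b) (ht : Near t c) (h : s ⊆ t) :
    b ≤ c := by
  rw [← sdiff_eq_bot_iff]
  apply eq_bot_of_negl
  refine (hs.2.union ht.1).mono ?_
  intro P hP
  rw [_root_.sdiff_eq] at hP
  have h1 := basicSet_mono inf_le_left hP
  have h2 := basicSet_mono inf_le_right hP
  rw [basicSet_compl] at h2
  by_cases hPs : P ∈ s
  · exact Or.inr ⟨h hPs, h2⟩
  · exact Or.inl ⟨h1, hPs⟩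

theorem Near.unique {s : Set (Pts B)} {b c : B} (hs : Near s b) (ht : Near s c) : b = c :=
  le_antisymm (hs.le ht subset_rfl) (ht.le hs subset_rfl)

theorem Near.compl {s : Set (Pts B)} {b : B} (h : Near s b) : Near sᶜ bᶜ := by
  rw [Near, basicSet_compl]
  refine ⟨h.2.mono ?_, h.1.mono ?_⟩
  · rintro P ⟨h1, h2⟩
    exact ⟨not_not.1 h2, h1⟩
  · rintro P ⟨h1, h2⟩
    exact ⟨not_not.1 h2, h1⟩

theorem Near.iUnion {s : ℕ → Set (Pts B)} {b : ℕ → B} {a : B} (h : ∀ n, Near (s n) (b n))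
    (ha : IsLUB (range b) a) : Near (⋃ n, s n) a := by
  constructor
  · refine (Negl.iUnion fun n => (h n).1).mono ?_
    rintro P ⟨h1, h2⟩
    obtain ⟨n, hn⟩ := mem_iUnion.1 h1
    exact mem_iUnion.2 ⟨n, hn, fun hP => h2 (basicSet_mono (ha.1 ⟨n, rfl⟩) hP)⟩
  · have : Negl (basicSet a \ ⋃ k, basicSet (b k)) :=
      ⟨fun _ => b, fun _ => a, fun _ => ha, subset_iUnion_of_subset 0 subset_rfl⟩
    refine (this.union (Negl.iUnion fun n => (h n).2)).mono ?_
    rintro P ⟨h1, h2⟩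
    by_cases hP : P ∈ ⋃ k, basicSet (b k)
    · right
      obtain ⟨k, hk⟩ := mem_iUnion.1 hP
      exact mem_iUnion.2 ⟨k, hk, fun hs => h2 (mem_iUnion.2 ⟨k, hs⟩)⟩
    · exact Or.inl ⟨h1, hP⟩

theorem near_empty : Near (∅ : Set (Pts B)) ⊥ := by
  simpa [basicSet_bot] using near_basicSet (⊥ : B)

variable [SigmaComplete B]

instance : MeasurableSpace (Pts B) where
  MeasurableSet' s := ∃ b, Near s b
  measurableSet_empty := ⟨⊥, near_empty⟩
  measurableSet_compl := fun _ ⟨b, hb⟩ => ⟨bᶜ, hb.compl⟩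
  measurableSet_iUnion := fun s hs => by
    choose b hb using hs
    obtain ⟨a, ha⟩ := SigmaComplete.exists_isLUB b
    exact ⟨a, Near.iUnion hb ha⟩

/-- The element of `B` represented by a measurable set of prime ideals. -/
def repr (s : MSets (Pts B)) : B := s.2.choose

theorem near_repr (s : MSets (Pts B)) : Near s.1 (repr s) := s.2.choose_spec

theorem repr_eq {s : MSets (Pts B)} {b : B} (h : Near s.1 b) : repr s = b := (near_repr s).unique h

theorem repr_isLUB (E : ℕ → MSets (Pts B)) (a : MSets (Pts B)) (h : IsLUB (range E) a) :
    IsLUB (range fun n => repr (E n)) (repr a) := by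
  obtain ⟨c, hc⟩ := SigmaComplete.exists_isLUB fun n => repr (E n)
  have : repr a = c := by
    apply repr_eq
    rw [(isLUB_mSets_iff _ _).1 h]
    exact Near.iUnion (fun n => near_repr (E n)) hc
  rwa [this]

theorem repr_compl (s : MSets (Pts B)) : repr sᶜ = (repr s)ᶜ := repr_eq (near_repr s).compl

theorem repr_mono {s t : MSets (Pts B)} (h : s ≤ t) : repr s ≤ repr t :=
  (near_repr s).le (near_repr t) h

theorem repr_sup (s t : MSets (Pts B)) : repr (s ⊔ t) = repr s ⊔ repr t := by
  refine repr_eq ⟨((near_repr s).1.union (near_repr t).1).mono ?_,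
    ((near_repr s).2.union (near_repr t).2).mono ?_⟩
  · rw [basicSet_sup]
    rintro P ⟨h1 | h1, h2⟩
    · exact Or.inl ⟨h1, fun h => h2 (Or.inl h)⟩
    · exact Or.inr ⟨h1, fun h => h2 (Or.inr h)⟩
  · rw [basicSet_sup]
    rintro P ⟨h1 | h1, h2⟩
    · exact Or.inl ⟨h1, fun h => h2 (Or.inl h)⟩
    · exact Or.inr ⟨h1, fun h => h2 (Or.inr h)⟩

variable (B) in
/-- The presentation of `B` as a quotient of a `σ`-algebra of sets of prime ideals. -/
def present : SigmaHom (MSets (Pts B)) B where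
  toFun := repr
  map_sup' := repr_sup
  map_inf' s t := by
    have h : s ⊓ t = (sᶜ ⊔ tᶜ)ᶜ := by rw [compl_sup, compl_compl, compl_compl]
    rw [h, repr_compl, repr_sup, repr_compl, repr_compl, compl_sup, compl_compl, compl_compl]
  map_top' := repr_eq (by simpa [basicSet_top] using near_basicSet (⊤ : B))
  map_bot' := repr_eq near_empty
  map_isLUB' := repr_isLUB

theorem present_surjective : Function.Surjective (present B) := fun b =>
  ⟨⟨basicSet b, b, near_basicSet b⟩, repr_eq (near_basicSet b)⟩

end Presentation

/-! ### Abstractly measurable functions -/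

/-- An abstractly measurable function from (the abstract space with algebra) `B` to the measurable
space `Z`: a morphism in the opposite direction, from the measurable subsets of `Z` to `B`. -/
abbrev AbsFun (Z : Type v) [MeasurableSpace Z] (B : Type u) [BooleanAlgebra B] : Type (max u v) :=
  SigmaHom (MSets Z) B

section Lifting

variable {B : Type u} [BooleanAlgebra B] {Z : Type v} [MeasurableSpace Z]
  {W : Type w} [MeasurableSpace W]

/-- Post-composition of an abstractly measurable function with a measurable map. -/
def AbsFun.post (F : Z → W) (hF : Measurable F) (f : AbsFun Z B) : AbsFun W B :=
  f.comp (preimageHom F hF)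

/-- Every abstractly measurable function with values in a standard Borel space lifts to a
measurable function along a surjective morphism from a `σ`-algebra of sets. -/
theorem exists_lift [StandardBorelSpace Z] [Nonempty Z] {Ω : Type w} [MeasurableSpace Ω]
    {π : SigmaHom (MSets Ω) B} (hπ : Function.Surjective π) (f : AbsFun Z B) :
    ∃ (F : Ω → Z) (hF : Measurable F), f = AbsFun.post F hF π := by
  obtain ⟨e, he, hinj⟩ := MeasurableSpace.measurable_injection_nat_bool_of_countablySeparated Z
  have hemb : MeasurableEmbedding e := he.measurableEmbedding hinj
  have hm : ∀ n, MeasurableSet {x : ℕ → Bool | x n = true} := fun n =>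
    (measurable_pi_apply n : Measurable fun x : ℕ → Bool => x n) (measurableSet_singleton true)
  choose S hS using fun n => hπ (f ⟨e ⁻¹' {x | x n = true}, he (hm n)⟩)
  classical
  let G : Ω → ℕ → Bool := fun ω n => decide (ω ∈ (S n : Set Ω))
  have hGpre : ∀ n, G ⁻¹' {x | x n = true} = S n := fun n => by ext ω; simp [G]
  have hG : Measurable G := by
    rw [measurable_pi_iff]
    intro n
    refine measurable_to_bool ?_
    have : (fun ω => G ω n) ⁻¹' {true} = S n := hGpre n
    rw [this]
    exact (S n).2
  have hGf : AbsFun.post G hG π = AbsFun.post e he f := by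
    have hgen : (MeasurableSpace.pi : MeasurableSpace (ℕ → Bool)) =
        MeasurableSpace.generateFrom (range fun n => {x : ℕ → Bool | x n = true}) := by
      apply le_antisymm
      · refine iSup_le fun n => ?_
        rw [← measurable_iff_comap_le]
        refine @measurable_to_bool _ (MeasurableSpace.generateFrom _) _ ?_
        exact MeasurableSpace.measurableSet_generateFrom ⟨n, rfl⟩
      · refine MeasurableSpace.generateFrom_le ?_
        rintro _ ⟨n, rfl⟩
        exact hm n
    refine mSets_hom_ext hgen ?_
    rintro _ ⟨n, rfl⟩ h
    refine Eq.trans ?_ (hS n)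
    exact congrArg π (Subtype.ext (hGpre n))
  obtain ⟨F₀, hF₀, hF₀e⟩ := hemb.exists_measurable_extend (measurable_id (α := Z))
    (fun _ => inferInstance)
  refine ⟨F₀ ∘ G, hF₀.comp hG, ?_⟩
  ext s
  have h1 : AbsFun.post (F₀ ∘ G) (hF₀.comp hG) π s =
      AbsFun.post G hG π (preimageHom F₀ hF₀ s) := rfl
  rw [h1, hGf]
  refine congrArg f (Subtype.ext ?_)
  change (s : Set Z) = e ⁻¹' (F₀ ⁻¹' s)
  rw [← preimage_comp, hF₀e, preimage_id]

theorem post_prodMk_fst {Ω : Type*} [MeasurableSpace Ω] (π : SigmaHom (MSets Ω) B) {F : Ω → Z}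
    {G : Ω → W} (hF : Measurable F) (hG : Measurable G) :
    AbsFun.post Prod.fst measurable_fst (AbsFun.post _ (hF.prodMk hG) π) = AbsFun.post F hF π := rfl

theorem joint_unique {k l : AbsFun (Z × W) B}
    (h1 : AbsFun.post Prod.fst measurable_fst k = AbsFun.post Prod.fst measurable_fst l)
    (h2 : AbsFun.post Prod.snd measurable_snd k = AbsFun.post Prod.snd measurable_snd l) :
    k = l := by
  refine mSets_hom_ext generateFrom_prod.symm ?_
  rintro _ ⟨s, hs, t, ht, rfl⟩ h
  have e : (⟨s ×ˢ t, h⟩ : MSets (Z × W)) =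
      preimageHom Prod.fst measurable_fst ⟨s, hs⟩ ⊓ preimageHom Prod.snd measurable_snd ⟨t, ht⟩ :=
    Subtype.ext (by ext; rfl)
  rw [e, map_inf, map_inf]
  exact congrArg₂ _ (DFunLike.congr_fun h1 ⟨s, hs⟩) (DFunLike.congr_fun h2 ⟨t, ht⟩)

/-- Two abstractly measurable functions have exactly one joint abstractly measurable function into
the product. -/
theorem existsUnique_joint [SigmaComplete B] [StandardBorelSpace Z] [StandardBorelSpace W]
    [Nonempty Z] [Nonempty W] (f : AbsFun Z B) (g : AbsFun W B) :
    ∃! k : AbsFun (Z × W) B, AbsFun.post Prod.fst measurable_fst k = f ∧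
      AbsFun.post Prod.snd measurable_snd k = g := by
  obtain ⟨F, hF, rfl⟩ := exists_lift present_surjective f
  obtain ⟨G, hG, rfl⟩ := exists_lift present_surjective g
  refine ⟨AbsFun.post _ (hF.prodMk hG) (present B), ⟨rfl, rfl⟩, ?_⟩
  rintro l ⟨h1, h2⟩
  exact joint_unique h1 h2

/-- The joint abstractly measurable function `(f, g)`. -/
def AbsFun.joint [SigmaComplete B] [StandardBorelSpace Z] [StandardBorelSpace W]
    [Nonempty Z] [Nonempty W] (f : AbsFun Z B) (g : AbsFun W B) : AbsFun (Z × W) B :=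
  (existsUnique_joint f g).choose

theorem AbsFun.joint_eq [SigmaComplete B] [StandardBorelSpace Z] [StandardBorelSpace W]
    [Nonempty Z] [Nonempty W] {f : AbsFun Z B} {g : AbsFun W B} {k : AbsFun (Z × W) B}
    (h1 : AbsFun.post Prod.fst measurable_fst k = f)
    (h2 : AbsFun.post Prod.snd measurable_snd k = g) : f.joint g = k :=
  (existsUnique_joint f g).unique (existsUnique_joint f g).choose_spec.1 ⟨h1, h2⟩

theorem AbsFun.joint_fst [SigmaComplete B] [StandardBorelSpace Z] [StandardBorelSpace W]
    [Nonempty Z] [Nonempty W] (f : AbsFun Z B) (g : AbsFun W B) :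
    AbsFun.post Prod.fst measurable_fst (f.joint g) = f :=
  (existsUnique_joint f g).choose_spec.1.1

theorem AbsFun.joint_snd [SigmaComplete B] [StandardBorelSpace Z] [StandardBorelSpace W]
    [Nonempty Z] [Nonempty W] (f : AbsFun Z B) (g : AbsFun W B) :
    AbsFun.post Prod.snd measurable_snd (f.joint g) = g :=
  (existsUnique_joint f g).choose_spec.1.2

end Lifting

/-! ### The commutative `C⋆`-algebra `L^∞` of a `σ`-complete Boolean algebra -/

/-- The closed disc of radius `M`. -/
def disc (M : ℝ) : MSets ℂ := ⟨{z | ‖z‖ ≤ M}, measurableSet_le measurable_norm measurable_const⟩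

/-- `L^∞(B)`: the bounded abstractly measurable functions from `B` to `ℂ`. -/
@[ext]
structure Linf (B : Type u) [BooleanAlgebra B] : Type u where
  /-- The underlying abstractly measurable function. -/
  toAbsFun : AbsFun ℂ B
  bounded : ∃ M : ℝ, toAbsFun (disc M) = ⊤

namespace SigmaHom

variable {A : Type u} {B : Type v} [BooleanAlgebra A] [BooleanAlgebra B] (π : SigmaHom A B)

theorem eq_top_mono {a b : A} (h : a ≤ b) (ha : π a = ⊤) : π b = ⊤ :=
  top_le_iff.1 (ha ▸ OrderHomClass.mono π h)

theorem eq_of_inf_eq {a b c : A} (hc : π c = ⊤) (h : a ⊓ c = b ⊓ c) : π a = π b := by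
  have := congrArg π h
  rwa [map_inf, map_inf, hc, inf_top_eq, inf_top_eq] at this

end SigmaHom

section Countable

variable {B : Type u} [BooleanAlgebra B] {Ω : Type v} [MeasurableSpace Ω]

theorem iInter_eq_top (π : SigmaHom (MSets Ω) B) {E : ℕ → Set Ω} (hE : ∀ n, MeasurableSet (E n))
    (h : ∀ n, π ⟨E n, hE n⟩ = ⊤) : π ⟨⋂ n, E n, MeasurableSet.iInter hE⟩ = ⊤ := by
  have h1 : IsGLB (range fun n => (⟨E n, hE n⟩ : MSets Ω)) ⟨⋂ n, E n, MeasurableSet.iInter hE⟩ := by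
    constructor
    · rintro _ ⟨n, rfl⟩
      exact iInter_subset E n
    · intro b hb
      exact subset_iInter fun n => hb ⟨n, rfl⟩
  have h2 := π.map_isGLB h1
  simp only [h, range_const] at h2
  exact h2.unique isGLB_singleton

end Countable

namespace Linf

variable {B : Type u} [BooleanAlgebra B]

/-- Apply a measurable unary operation, bounded on bounded sets. -/
def op₁ (φ : ℂ → ℂ) (hφ : Measurable φ) (hb : ∀ M : ℝ, ∃ K : ℝ, ∀ z, ‖z‖ ≤ M → ‖φ z‖ ≤ K)
    (f : Linf B) : Linf B where
  toAbsFun := f.toAbsFun.post φ hφ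
  bounded := by
    obtain ⟨M, hM⟩ := f.bounded
    obtain ⟨K, hK⟩ := hb M
    exact ⟨K, f.toAbsFun.eq_top_mono (a := disc M) (b := preimageHom φ hφ (disc K)) hK hM⟩

/-- The constant functions. -/
def const (c : ℂ) : Linf B where
  toAbsFun := open Classical in
    { toFun := fun s => if c ∈ (s : Set ℂ) then ⊤ else ⊥
      map_sup' := fun s t => by
        by_cases h1 : c ∈ (s : Set ℂ) <;> by_cases h2 : c ∈ (t : Set ℂ) <;> simp [h1, h2]
      map_inf' := fun s t => by
        by_cases h1 : c ∈ (s : Set ℂ) <;> by_cases h2 : c ∈ (t : Set ℂ) <;> simp [h1, h2]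
      map_top' := by simp
      map_bot' := by simp
      map_isLUB' := fun E a h => by
        rw [isLUB_mSets_iff] at h
        by_cases hc : c ∈ (a : Set ℂ)
        · have hc' := hc
          rw [h, mem_iUnion] at hc'
          obtain ⟨n, hn⟩ := hc'
          simp only [hc, if_true]
          exact ⟨fun _ _ => le_top, fun b hb => hb ⟨n, by simp [hn]⟩⟩
        · have hc' : ∀ n, c ∉ (E n : Set ℂ) := fun n hn => hc (h ▸ mem_iUnion.2 ⟨n, hn⟩)
          simp [hc, hc'] }
  bounded := ⟨‖c‖, if_pos (le_refl ‖c‖)⟩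

theorem disc_joint [SigmaComplete B] {f g : AbsFun ℂ B} {M N : ℝ} (hf : f (disc M) = ⊤)
    (hg : g (disc N) = ⊤) :
    f.joint g (preimageHom Prod.fst measurable_fst (disc M) ⊓
      preimageHom Prod.snd measurable_snd (disc N)) = ⊤ := by
  rw [map_inf]
  have h1 := DFunLike.congr_fun (AbsFun.joint_fst f g) (disc M)
  have h2 := DFunLike.congr_fun (AbsFun.joint_snd f g) (disc N)
  rw [hf] at h1
  rw [hg] at h2
  exact (congrArg₂ _ h1 h2).trans (inf_top_eq _)

/-- Apply a measurable binary operation, bounded on bounded sets, to the joint function `(f, g)`. -/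
def op₂ [SigmaComplete B] (φ : ℂ × ℂ → ℂ) (hφ : Measurable φ)
    (hb : ∀ M N : ℝ, ∃ K : ℝ, ∀ z w, ‖z‖ ≤ M → ‖w‖ ≤ N → ‖φ (z, w)‖ ≤ K) (f g : Linf B) :
    Linf B where
  toAbsFun := (f.toAbsFun.joint g.toAbsFun).post φ hφ
  bounded := by
    obtain ⟨M, hM⟩ := f.bounded
    obtain ⟨N, hN⟩ := g.bounded
    obtain ⟨K, hK⟩ := hb M N
    have hle : preimageHom Prod.fst measurable_fst (disc M) ⊓
        preimageHom Prod.snd measurable_snd (disc N) ≤ preimageHom φ hφ (disc K) :=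
      fun p hp => hK p.1 p.2 hp.1 hp.2
    exact ⟨K, (f.toAbsFun.joint g.toAbsFun).eq_top_mono hle (disc_joint hM hN)⟩

instance : Zero (Linf B) := ⟨const 0⟩

instance : One (Linf B) := ⟨const 1⟩

instance : Neg (Linf B) := ⟨op₁ (fun z => -z) measurable_neg fun M => ⟨M, fun z h => by simpa using h⟩⟩

instance : Star (Linf B) :=
  ⟨op₁ (fun z => star z) Complex.continuous_conj.measurable fun M => ⟨M, fun z h => by simpa using h⟩⟩

instance : SMul ℂ (Linf B) :=
  ⟨fun c => op₁ (fun z => c * z) (measurable_const_mul c) fun M => ⟨‖c‖ * M, fun z h => by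
    rw [norm_mul]; exact mul_le_mul_of_nonneg_left h (norm_nonneg c)⟩⟩

/-- The norm of `f` is the infimum of all `M ≥ 0` with `‖f‖ ≤ M`. -/
instance instNorm : Norm (Linf B) := ⟨fun f => sInf {M : ℝ | 0 ≤ M ∧ f.toAbsFun (disc M) = ⊤}⟩

theorem norm_nonneg' (f : Linf B) : 0 ≤ ‖f‖ := Real.sInf_nonneg fun _ h => h.1

theorem apply_disc_norm (f : Linf B) : f.toAbsFun (disc ‖f‖) = ⊤ := by
  obtain ⟨M, hM⟩ := f.bounded
  have hne : {M : ℝ | 0 ≤ M ∧ f.toAbsFun (disc M) = ⊤}.Nonempty :=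
    ⟨max M 0, le_max_right _ _, SigmaHom.eq_top_mono _ (a := disc M)
      (fun z hz => le_trans hz (le_max_left M 0)) hM⟩
  have h := iInter_eq_top f.toAbsFun (E := fun n : ℕ => {z | ‖z‖ ≤ ‖f‖ + 1 / ((n : ℝ) + 1)})
    (fun n => (disc _).2) fun n => by
      obtain ⟨K, hK, hlt⟩ := exists_lt_of_csInf_lt hne
        (lt_add_of_pos_right ‖f‖ (Nat.one_div_pos_of_nat (n := n) (α := ℝ)))
      exact SigmaHom.eq_top_mono _ (a := disc K) (fun z hz => le_trans hz hlt.le) hK.2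
  refine SigmaHom.eq_top_mono _ ?_ h
  intro z hz
  change ‖z‖ ≤ ‖f‖
  have hz' : ∀ n : ℕ, ‖z‖ ≤ ‖f‖ + 1 / ((n : ℝ) + 1) := fun n => mem_iInter.1 hz n
  refine le_of_forall_pos_le_add fun ε hε => ?_
  obtain ⟨n, hn⟩ := exists_nat_one_div_lt hε
  exact (hz' n).trans (by linarith)

theorem norm_le_iff {f : Linf B} {M : ℝ} (hM : 0 ≤ M) : ‖f‖ ≤ M ↔ f.toAbsFun (disc M) = ⊤ := by
  constructor
  · intro h
    exact SigmaHom.eq_top_mono _ (fun z hz => le_trans hz h) (apply_disc_norm f)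
  · intro h
    exact csInf_le ⟨0, fun _ h => h.1⟩ ⟨hM, h⟩

variable [SigmaComplete B]

/-- The sum of `f` and `g` is the joint function `(f, g)` followed by addition `ℂ × ℂ → ℂ`. -/
instance : Add (Linf B) :=
  ⟨op₂ (fun p => p.1 + p.2) (measurable_fst.add measurable_snd) fun M N => ⟨M + N, fun z w hz hw =>
    (norm_add_le z w).trans (add_le_add hz hw)⟩⟩

/-- The product of `f` and `g` is the joint function followed by multiplication `ℂ × ℂ → ℂ`. -/
instance : Mul (Linf B) :=
  ⟨op₂ (fun p => p.1 * p.2) (measurable_fst.mul measurable_snd) fun M N => ⟨M * N, fun z w hz hw => by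
    rw [norm_mul]
    exact mul_le_mul hz hw (norm_nonneg w) ((norm_nonneg z).trans hz)⟩⟩

variable (B) in
/-- Bounded measurable functions on the presentation of `B`. -/
def BMeas : StarSubalgebra ℂ (Pts B → ℂ) where
  carrier := {F | Measurable F ∧ ∃ M : ℝ, ∀ ω, ‖F ω‖ ≤ M}
  mul_mem' := by
    rintro F G ⟨hF, M, hM⟩ ⟨hG, N, hN⟩
    refine ⟨hF.mul hG, M * N, fun ω => ?_⟩
    rw [Pi.mul_apply, norm_mul]
    exact mul_le_mul (hM ω) (hN ω) (norm_nonneg _) ((norm_nonneg _).trans (hM ω))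
  add_mem' := by
    rintro F G ⟨hF, M, hM⟩ ⟨hG, N, hN⟩
    exact ⟨hF.add hG, M + N, fun ω => (norm_add_le _ _).trans (add_le_add (hM ω) (hN ω))⟩
  algebraMap_mem' c := ⟨measurable_const, ‖c‖, fun ω => le_rfl⟩
  star_mem' := by
    rintro F ⟨hF, M, hM⟩
    exact ⟨Complex.continuous_conj.measurable.comp hF, M, fun ω => by simpa using hM ω⟩

/-- The class of a bounded measurable function. -/
def q (F : BMeas B) : Linf B where
  toAbsFun := AbsFun.post F.1 F.2.1 (present B)
  bounded := by
    obtain ⟨M, hM⟩ := F.2.2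
    exact ⟨M, (present B).eq_top_mono (a := ⊤) (b := preimageHom F.1 F.2.1 (disc M))
      (fun ω _ => hM ω) (map_top _)⟩

theorem q_congr {F G : BMeas B} {T : Set (Pts B)} (hT : MeasurableSet T)
    (h : present B ⟨T, hT⟩ = ⊤) (hFG : ∀ ω ∈ T, F.1 ω = G.1 ω) : q F = q G := by
  refine Linf.ext (SigmaHom.ext fun s => ?_)
  refine SigmaHom.eq_of_inf_eq (present B) h (Subtype.ext ?_)
  ext ω
  change F.1 ω ∈ (s : Set ℂ) ∧ ω ∈ T ↔ G.1 ω ∈ (s : Set ℂ) ∧ ω ∈ T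
  constructor
  · rintro ⟨h1, h2⟩
    exact ⟨hFG ω h2 ▸ h1, h2⟩
  · rintro ⟨h1, h2⟩
    exact ⟨(hFG ω h2).symm ▸ h1, h2⟩

theorem q_surjective : Function.Surjective (q : BMeas B → Linf B) := by
  intro f
  obtain ⟨F, hF, h⟩ := exists_lift present_surjective f.toAbsFun
  obtain ⟨M, hM⟩ := f.bounded
  have hT : MeasurableSet {ω | ‖F ω‖ ≤ M} := hF (disc M).2
  have hTtop : present B ⟨_, hT⟩ = ⊤ := by rw [h] at hM; exact hM
  let G : BMeas B := ⟨indicator {ω | ‖F ω‖ ≤ M} F, hF.indicator hT, max M 0, fun ω => by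
    by_cases hω : ω ∈ {ω | ‖F ω‖ ≤ M}
    · rw [indicator_of_mem hω]
      exact le_max_of_le_left hω
    · rw [indicator_of_notMem hω]
      simp⟩
  refine ⟨G, Linf.ext ?_⟩
  rw [h]
  refine SigmaHom.ext fun s => ?_
  refine SigmaHom.eq_of_inf_eq (present B) hTtop (Subtype.ext ?_)
  ext ω
  change indicator {ω | ‖F ω‖ ≤ M} F ω ∈ (s : Set ℂ) ∧ ω ∈ {ω | ‖F ω‖ ≤ M} ↔
    F ω ∈ (s : Set ℂ) ∧ ω ∈ {ω | ‖F ω‖ ≤ M}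
  constructor
  · rintro ⟨h1, h2⟩
    rw [indicator_of_mem h2] at h1
    exact ⟨h1, h2⟩
  · rintro ⟨h1, h2⟩
    refine ⟨?_, h2⟩
    rwa [indicator_of_mem h2]

theorem q_op₂ (φ : ℂ × ℂ → ℂ) (hφ : Measurable φ)
    (hb : ∀ M N : ℝ, ∃ K : ℝ, ∀ z w, ‖z‖ ≤ M → ‖w‖ ≤ N → ‖φ (z, w)‖ ≤ K) (F G H : BMeas B)
    (h : ∀ ω, H.1 ω = φ (F.1 ω, G.1 ω)) : op₂ φ hφ hb (q F) (q G) = q H := by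
  refine Linf.ext ?_
  have hj : (q F).toAbsFun.joint (q G).toAbsFun =
      AbsFun.post _ (F.2.1.prodMk G.2.1) (present B) := AbsFun.joint_eq rfl rfl
  change AbsFun.post φ hφ ((q F).toAbsFun.joint (q G).toAbsFun) = _
  rw [hj]
  refine SigmaHom.ext fun s => congrArg (present B) (Subtype.ext ?_)
  ext ω
  change φ (F.1 ω, G.1 ω) ∈ (s : Set ℂ) ↔ H.1 ω ∈ (s : Set ℂ)
  rw [h]

theorem q_op₁ (φ : ℂ → ℂ) (hφ : Measurable φ)
    (hb : ∀ M : ℝ, ∃ K : ℝ, ∀ z, ‖z‖ ≤ M → ‖φ z‖ ≤ K) (F H : BMeas B)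
    (h : ∀ ω, H.1 ω = φ (F.1 ω)) : op₁ φ hφ hb (q F) = q H := by
  refine Linf.ext (SigmaHom.ext fun s => congrArg (present B) (Subtype.ext ?_))
  ext ω
  change φ (F.1 ω) ∈ (s : Set ℂ) ↔ H.1 ω ∈ (s : Set ℂ)
  rw [h]

theorem q_const (c : ℂ) (H : BMeas B) (h : ∀ ω, H.1 ω = c) : const c = q H := by
  refine Linf.ext (SigmaHom.ext fun s => ?_)
  classical
  change (if c ∈ (s : Set ℂ) then (⊤ : B) else ⊥) = present B (preimageHom H.1 H.2.1 s)
  split_ifs with hc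
  · rw [← map_top (present B)]
    congr 1
    refine Subtype.ext (Eq.symm ?_)
    ext ω
    change H.1 ω ∈ (s : Set ℂ) ↔ True
    simp [h, hc]
  · rw [← BotHomClass.map_bot (present B)]
    congr 1
    refine Subtype.ext (Eq.symm ?_)
    ext ω
    change H.1 ω ∈ (s : Set ℂ) ↔ False
    simp [h, hc]

theorem q_zero : (0 : Linf B) = q 0 := q_const 0 0 fun _ => rfl

theorem q_one : (1 : Linf B) = q 1 := q_const 1 1 fun _ => rfl

theorem q_add (F G : BMeas B) : q F + q G = q (F + G) := q_op₂ _ _ _ _ _ _ fun _ => rfl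

theorem q_mul (F G : BMeas B) : q F * q G = q (F * G) := q_op₂ _ _ _ _ _ _ fun _ => rfl

theorem q_neg (F : BMeas B) : -q F = q (-F) := q_op₁ _ _ _ _ _ fun _ => rfl

theorem q_star (F : BMeas B) : star (q F) = q (star F) := q_op₁ _ _ _ _ _ fun _ => rfl

theorem q_smul (c : ℂ) (F : BMeas B) : c • q F = q (c • F) := q_op₁ _ _ _ _ _ fun _ => rfl

instance instCommRing : CommRing (Linf B) where
  add_assoc a b c := by
    obtain ⟨F, rfl⟩ := q_surjective a
    obtain ⟨G, rfl⟩ := q_surjective b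
    obtain ⟨H, rfl⟩ := q_surjective c
    simp only [q_add, add_assoc]
  zero_add a := by
    obtain ⟨F, rfl⟩ := q_surjective a
    rw [q_zero, q_add, zero_add]
  add_zero a := by
    obtain ⟨F, rfl⟩ := q_surjective a
    rw [q_zero, q_add, add_zero]
  add_comm a b := by
    obtain ⟨F, rfl⟩ := q_surjective a
    obtain ⟨G, rfl⟩ := q_surjective b
    simp only [q_add, add_comm]
  neg_add_cancel a := by
    obtain ⟨F, rfl⟩ := q_surjective a
    rw [q_zero, q_neg, q_add, neg_add_cancel]
  left_distrib a b c := by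
    obtain ⟨F, rfl⟩ := q_surjective a
    obtain ⟨G, rfl⟩ := q_surjective b
    obtain ⟨H, rfl⟩ := q_surjective c
    simp only [q_add, q_mul, mul_add]
  right_distrib a b c := by
    obtain ⟨F, rfl⟩ := q_surjective a
    obtain ⟨G, rfl⟩ := q_surjective b
    obtain ⟨H, rfl⟩ := q_surjective c
    simp only [q_add, q_mul, add_mul]
  zero_mul a := by
    obtain ⟨F, rfl⟩ := q_surjective a
    rw [q_zero, q_mul, zero_mul]
  mul_zero a := by
    obtain ⟨F, rfl⟩ := q_surjective a
    rw [q_zero, q_mul, mul_zero]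
  mul_assoc a b c := by
    obtain ⟨F, rfl⟩ := q_surjective a
    obtain ⟨G, rfl⟩ := q_surjective b
    obtain ⟨H, rfl⟩ := q_surjective c
    simp only [q_mul, mul_assoc]
  one_mul a := by
    obtain ⟨F, rfl⟩ := q_surjective a
    rw [q_one, q_mul, one_mul]
  mul_one a := by
    obtain ⟨F, rfl⟩ := q_surjective a
    rw [q_one, q_mul, mul_one]
  mul_comm a b := by
    obtain ⟨F, rfl⟩ := q_surjective a
    obtain ⟨G, rfl⟩ := q_surjective b
    simp only [q_mul, mul_comm]
  nsmul := nsmulRec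
  zsmul := zsmulRec

theorem q_sub (F G : BMeas B) : q F - q G = q (F - G) := by
  rw [sub_eq_add_neg, q_neg, q_add, sub_eq_add_neg]

instance : Module ℂ (Linf B) where
  one_smul a := by
    obtain ⟨F, rfl⟩ := q_surjective a
    rw [q_smul, one_smul]
  mul_smul c d a := by
    obtain ⟨F, rfl⟩ := q_surjective a
    simp only [q_smul, mul_smul]
  smul_zero c := by rw [q_zero, q_smul, smul_zero]
  smul_add c a b := by
    obtain ⟨F, rfl⟩ := q_surjective a
    obtain ⟨G, rfl⟩ := q_surjective b
    simp only [q_smul, q_add, smul_add]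
  add_smul c d a := by
    obtain ⟨F, rfl⟩ := q_surjective a
    simp only [q_smul, q_add, add_smul]
  zero_smul a := by
    obtain ⟨F, rfl⟩ := q_surjective a
    rw [q_smul, zero_smul, q_zero]

instance : Algebra ℂ (Linf B) := Algebra.ofModule
  (fun c a b => by
    obtain ⟨F, rfl⟩ := q_surjective a
    obtain ⟨G, rfl⟩ := q_surjective b
    simp only [q_smul, q_mul, smul_mul_assoc])
  (fun c a b => by
    obtain ⟨F, rfl⟩ := q_surjective a
    obtain ⟨G, rfl⟩ := q_surjective b
    simp only [q_smul, q_mul, mul_smul_comm])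

instance : StarRing (Linf B) where
  star_involutive a := by
    obtain ⟨F, rfl⟩ := q_surjective a
    simp only [q_star, star_star]
  star_mul a b := by
    obtain ⟨F, rfl⟩ := q_surjective a
    obtain ⟨G, rfl⟩ := q_surjective b
    simp only [q_star, q_mul, star_mul]
  star_add a b := by
    obtain ⟨F, rfl⟩ := q_surjective a
    obtain ⟨G, rfl⟩ := q_surjective b
    simp only [q_star, q_add, star_add]

instance : StarModule ℂ (Linf B) where
  star_smul c a := by
    obtain ⟨F, rfl⟩ := q_surjective a
    simp only [q_star, q_smul, star_smul]

theorem norm_q_le_iff {F : BMeas B} {M : ℝ} (hM : 0 ≤ M) :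
    ‖q F‖ ≤ M ↔ present B ⟨{ω | ‖F.1 ω‖ ≤ M}, F.2.1 (disc M).2⟩ = ⊤ := norm_le_iff hM

theorem present_norm_q (F : BMeas B) :
    present B ⟨{ω | ‖F.1 ω‖ ≤ ‖q F‖}, F.2.1 (disc _).2⟩ = ⊤ := apply_disc_norm (q F)

theorem norm_q_le_of {F G : BMeas B} {M : ℝ} (hM : 0 ≤ M)
    (h : ∀ ω, ‖F.1 ω‖ ≤ ‖q F‖ → ‖G.1 ω‖ ≤ M) : ‖q G‖ ≤ M := by
  have hle : (⟨{ω | ‖F.1 ω‖ ≤ ‖q F‖}, F.2.1 (disc _).2⟩ : MSets (Pts B)) ≤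
    ⟨{ω | ‖G.1 ω‖ ≤ M}, G.2.1 (disc M).2⟩ := fun ω hω => h ω hω
  exact (norm_q_le_iff hM).2 (SigmaHom.eq_top_mono _ hle (present_norm_q F))

theorem norm_q_le_of₂ {F G H : BMeas B} {M : ℝ} (hM : 0 ≤ M)
    (h : ∀ ω, ‖F.1 ω‖ ≤ ‖q F‖ → ‖G.1 ω‖ ≤ ‖q G‖ → ‖H.1 ω‖ ≤ M) : ‖q H‖ ≤ M := by
  have hle : (⟨{ω | ‖F.1 ω‖ ≤ ‖q F‖}, F.2.1 (disc _).2⟩ : MSets (Pts B)) ⊓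
      ⟨{ω | ‖G.1 ω‖ ≤ ‖q G‖}, G.2.1 (disc _).2⟩ ≤ ⟨{ω | ‖H.1 ω‖ ≤ M}, H.2.1 (disc M).2⟩ :=
    fun ω hω => h ω hω.1 hω.2
  refine (norm_q_le_iff hM).2 (SigmaHom.eq_top_mono _ hle ?_)
  rw [map_inf, present_norm_q, present_norm_q, inf_top_eq]

variable (B) in
/-- The norm of `L^∞` as a ring norm. -/
def ringNorm : RingNorm (Linf B) where
  toFun f := ‖f‖
  map_zero' := by
    refine le_antisymm ?_ (norm_nonneg' _)
    rw [q_zero, norm_q_le_iff le_rfl]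
    exact SigmaHom.eq_top_mono _ (a := ⊤) (fun ω _ => norm_zero.le) (map_top _)
  add_le' f g := by
    obtain ⟨F, rfl⟩ := q_surjective f
    obtain ⟨G, rfl⟩ := q_surjective g
    rw [q_add]
    exact norm_q_le_of₂ (add_nonneg (norm_nonneg' _) (norm_nonneg' _)) fun ω h1 h2 =>
      (norm_add_le _ _).trans (add_le_add h1 h2)
  neg' f := by
    have h : ∀ F : BMeas B, ‖q (-F)‖ ≤ ‖q F‖ := fun F =>
      norm_q_le_of (norm_nonneg' _) fun ω h1 => (norm_neg (F.1 ω)).le.trans h1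
    obtain ⟨F, rfl⟩ := q_surjective f
    rw [q_neg]
    refine le_antisymm (h F) ?_
    simpa only [neg_neg] using h (-F)
  mul_le' f g := by
    obtain ⟨F, rfl⟩ := q_surjective f
    obtain ⟨G, rfl⟩ := q_surjective g
    rw [q_mul]
    exact norm_q_le_of₂ (mul_nonneg (norm_nonneg' _) (norm_nonneg' _)) fun ω h1 h2 =>
      (norm_mul_le _ _).trans (mul_le_mul h1 h2 (norm_nonneg _) (norm_nonneg' _))
  eq_zero_of_map_eq_zero' f hf := by
    obtain ⟨F, rfl⟩ := q_surjective f
    have h := present_norm_q F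
    rw [q_zero]
    refine q_congr _ h fun ω hω => ?_
    have hω' : ‖F.1 ω‖ ≤ ‖q F‖ := hω
    rw [show ‖q F‖ = 0 from hf] at hω'
    exact norm_le_zero_iff.1 hω'

instance instNormedCommRing : NormedCommRing (Linf B) :=
  { RingNorm.toNormedRing (ringNorm B), instCommRing with toNorm := instNorm }

theorem completeSpace : CompleteSpace (Linf B) := by
  refine Metric.complete_of_cauchySeq_tendsto fun u hu => ?_
  choose F hF using fun n => q_surjective (u n)
  have hmeas : ∀ p : ℕ × ℕ, MeasurableSet {ω | ‖(F p.1 - F p.2).1 ω‖ ≤ ‖u p.1 - u p.2‖} :=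
    fun p => (F p.1 - F p.2).2.1 (disc _).2
  let T : Set (Pts B) := ⋂ n : ℕ, {ω | ‖(F n.unpair.1 - F n.unpair.2).1 ω‖ ≤
    ‖u n.unpair.1 - u n.unpair.2‖}
  have hT : MeasurableSet T := MeasurableSet.iInter fun n => hmeas n.unpair
  have hTtop : present B ⟨T, hT⟩ = ⊤ := by
    refine iInter_eq_top _ (fun n => hmeas n.unpair) fun n => ?_
    have h := present_norm_q (F n.unpair.1 - F n.unpair.2)
    simp only [← q_sub, hF] at h
    exact h
  have hTmem : ∀ ω ∈ T, ∀ n m, ‖(F n).1 ω - (F m).1 ω‖ ≤ ‖u n - u m‖ := by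
    intro ω hω n m
    have := mem_iInter.1 hω (Nat.pair n m)
    simpa using this
  have hcau : ∀ ω ∈ T, CauchySeq fun n => (F n).1 ω := by
    intro ω hω
    rw [Metric.cauchySeq_iff] at hu ⊢
    intro ε hε
    obtain ⟨N, hN⟩ := hu ε hε
    refine ⟨N, fun m hm n hn => ?_⟩
    rw [dist_eq_norm]
    exact (hTmem ω hω m n).trans_lt (by rw [← dist_eq_norm]; exact hN m hm n hn)
  choose! L hL using fun ω hω => cauchySeq_tendsto_of_complete (hcau ω hω)
  have hlim : ∀ ω, Filter.Tendsto (fun n => indicator T (F n).1 ω) Filter.atTop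
      (nhds (indicator T L ω)) := by
    intro ω
    by_cases hω : ω ∈ T
    · simp only [indicator_of_mem hω]
      exact hL ω hω
    · simp only [indicator_of_notMem hω]
      exact tendsto_const_nhds
  have hGm : Measurable (indicator T L) :=
    measurable_of_tendsto_metrizable (fun n => (F n).2.1.indicator hT) (tendsto_pi_nhds.2 hlim)
  obtain ⟨R, -, hR⟩ := cauchySeq_bdd hu
  obtain ⟨M, hM⟩ := (F 0).2.2
  have hGb : ∀ ω, ‖indicator T L ω‖ ≤ max (R + M) 0 := by
    intro ω
    by_cases hω : ω ∈ T
    · rw [indicator_of_mem hω]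
      refine le_max_of_le_left (le_of_tendsto (hL ω hω).norm (Filter.Eventually.of_forall fun n => ?_))
      have h1 : ‖(F n).1 ω - (F 0).1 ω‖ ≤ R :=
        (hTmem ω hω n 0).trans (by rw [← dist_eq_norm]; exact (hR n 0).le)
      have h2 := norm_add_le ((F n).1 ω - (F 0).1 ω) ((F 0).1 ω)
      rw [sub_add_cancel] at h2
      exact h2.trans (add_le_add h1 (hM ω))
    · rw [indicator_of_notMem hω]
      simp
  let G : BMeas B := ⟨indicator T L, hGm, _, hGb⟩
  refine ⟨q G, ?_⟩
  rw [Metric.tendsto_atTop]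
  intro ε hε
  obtain ⟨N, hN⟩ := Metric.cauchySeq_iff.1 hu (ε / 2) (half_pos hε)
  refine ⟨N, fun n hn => lt_of_le_of_lt ?_ (half_lt_self hε)⟩
  rw [dist_eq_norm, ← hF n, q_sub, norm_q_le_iff (half_pos hε).le]
  refine SigmaHom.eq_top_mono _ (a := ⟨T, hT⟩) (fun ω hω => ?_) hTtop
  have hω : ω ∈ T := hω
  change ‖(F n).1 ω - indicator T L ω‖ ≤ ε / 2
  rw [indicator_of_mem hω]
  refine le_of_tendsto (tendsto_const_nhds.sub (hL ω hω)).norm ?_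
  filter_upwards [Filter.eventually_ge_atTop N] with m hm
  exact (hTmem ω hω n m).trans (by rw [← dist_eq_norm]; exact (hN n hn m hm).le)

/-- `L^∞` is a commutative unital `C⋆`-algebra. -/
instance instCommCStarAlgebra : CommCStarAlgebra (Linf B) where
  toCompleteSpace := completeSpace
  norm_mul_self_le f := by
    obtain ⟨F, rfl⟩ := q_surjective f
    rw [q_star, q_mul]
    have h : ‖q F‖ ≤ √‖q (star F * F)‖ := norm_q_le_of (Real.sqrt_nonneg _) fun ω hω => by
      refine Real.le_sqrt_of_sq_le (le_trans (le_of_eq ?_) hω)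
      change _ = ‖star (F.1 ω) * F.1 ω‖
      rw [norm_mul, norm_star, sq]
    calc ‖q F‖ * ‖q F‖ ≤ √‖q (star F * F)‖ * √‖q (star F * F)‖ :=
          mul_le_mul h h (norm_nonneg _) (Real.sqrt_nonneg _)
      _ = _ := Real.mul_self_sqrt (norm_nonneg _)
  norm_smul_le c f := by
    obtain ⟨F, rfl⟩ := q_surjective f
    rw [q_smul]
    refine norm_q_le_of (F := F) (mul_nonneg (norm_nonneg _) (norm_nonneg _)) fun ω hω => ?_
    change ‖c * F.1 ω‖ ≤ _
    rw [norm_mul]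
    exact mul_le_mul_of_nonneg_left hω (norm_nonneg c)

end Linf

/-! ### Probability measures on `σ`-complete Boolean algebras -/

/-- A countably additive probability measure on a Boolean algebra. Its values lie in `[0, 1]`, since
they are nonnegative and bounded by the value at `⊤`. -/
@[ext]
structure ProbMeas (B : Type u) [BooleanAlgebra B] where
  /-- The measure of an element. -/
  toFun : B → ℝ≥0∞
  bot' : toFun ⊥ = 0
  top' : toFun ⊤ = 1
  tsum' : ∀ (E : ℕ → B) (a : B), (∀ i j, i ≠ j → Disjoint (E i) (E j)) → IsLUB (range E) a →
    toFun a = ∑' n, toFun (E n)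

theorem isLUB_inf {B : Type u} [BooleanAlgebra B] {E : ℕ → B} {a : B} (h : IsLUB (range E) a)
    (c : B) : IsLUB (range fun n => E n ⊓ c) (a ⊓ c) := by
  constructor
  · rintro _ ⟨n, rfl⟩
    exact inf_le_inf_right c (h.1 ⟨n, rfl⟩)
  · intro b hb
    rw [← le_himp_iff]
    refine h.2 ?_
    rintro _ ⟨n, rfl⟩
    rw [le_himp_iff]
    exact hb ⟨n, rfl⟩

theorem isLUB_disjointed {B : Type u} [BooleanAlgebra B] {E : ℕ → B} {a : B}
    (h : IsLUB (range E) a) : IsLUB (range (disjointed E)) a := by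
  rw [IsLUB, ← upperBounds_range_partialSups, partialSups_disjointed,
    upperBounds_range_partialSups]
  exact h

theorem isLUB_two {B : Type u} [BooleanAlgebra B] (a b : B) :
    IsLUB (range fun n : ℕ => if n = 0 then a else if n = 1 then b else ⊥) (a ⊔ b) := by
  constructor
  · rintro _ ⟨n, rfl⟩
    dsimp only
    split_ifs
    · exact le_sup_left
    · exact le_sup_right
    · exact bot_le
  · intro c hc
    exact sup_le (by simpa using hc ⟨0, rfl⟩) (by simpa using hc ⟨1, rfl⟩)

namespace ProbMeas

variable {B : Type u} [BooleanAlgebra B] (m : ProbMeas B)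

instance : CoeFun (ProbMeas B) fun _ => B → ℝ≥0∞ := ⟨toFun⟩

theorem sup_of_disjoint {a b : B} (h : Disjoint a b) : m (a ⊔ b) = m a + m b := by
  rw [m.tsum' _ _ ?_ (isLUB_two a b)]
  · rw [tsum_eq_sum (s := Finset.range 2)]
    · simp [Finset.sum_range_succ]
    · intro n hn
      have h0 : n ≠ 0 := by rintro rfl; simp at hn
      have h1 : n ≠ 1 := by rintro rfl; simp at hn
      simp [h0, h1, m.bot']
  · intro i j hij
    rcases i with _ | _ | i <;> rcases j with _ | _ | j <;> simp_all [h.symm]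

theorem mono {a b : B} (h : a ≤ b) : m a ≤ m b := by
  rw [← sup_sdiff_cancel_right h, m.sup_of_disjoint disjoint_sdiff_self_right]
  exact le_self_add

theorem le_sum {E : ℕ → B} {a : B} (h : IsLUB (range E) a) : m a ≤ ∑' n, m (E n) := by
  rw [m.tsum' _ _ (fun i j hij => disjoint_disjointed E hij) (isLUB_disjointed h)]
  exact ENNReal.tsum_le_tsum fun n => m.mono (disjointed_le E n)

theorem sup_le_add (a b : B) : m (a ⊔ b) ≤ m a + m b := by
  rw [← sup_sdiff_self_right, m.sup_of_disjoint disjoint_sdiff_self_right]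
  gcongr
  exact m.mono sdiff_le

theorem null_sup {a b : B} (ha : m a = 0) (hb : m b = 0) : m (a ⊔ b) = 0 :=
  le_antisymm ((m.sup_le_add a b).trans (by simp [ha, hb])) zero_le

theorem null_mono {a b : B} (h : a ≤ b) (hb : m b = 0) : m a = 0 :=
  le_antisymm ((m.mono h).trans hb.le) zero_le

/-! #### The quotient by the null ideal -/

/-- Two elements are identified if their symmetric difference is null. -/
def nullSetoid : Setoid B where
  r a b := m (a \ b) = 0 ∧ m (b \ a) = 0
  iseqv :=
    { refl := fun a => by simp [m.bot']
      symm := fun h => ⟨h.2, h.1⟩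
      trans := fun {a b c} h1 h2 =>
        ⟨m.null_mono (sdiff_triangle a b c) (m.null_sup h1.1 h2.1),
          m.null_mono (sdiff_triangle c b a) (m.null_sup h2.2 h1.2)⟩ }

/-- The quotient of `B` by the ideal of null elements. -/
def Quot : Type u := Quotient m.nullSetoid

/-- The quotient map. -/
def cls (a : B) : m.Quot := Quotient.mk m.nullSetoid a

theorem cls_surjective : Function.Surjective m.cls := Quotient.exists_rep

theorem cls_eq_iff {a b : B} : m.cls a = m.cls b ↔ m (a \ b) = 0 ∧ m (b \ a) = 0 :=
  ⟨fun h => Quotient.exact h, fun h => Quotient.sound h⟩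

theorem null_sdiff_trans {a b c : B} (h1 : m (a \ b) = 0) (h2 : m (b \ c) = 0) : m (a \ c) = 0 :=
  m.null_mono (sdiff_triangle a b c) (m.null_sup h1 h2)

instance : LE m.Quot where
  le x y := Quotient.liftOn₂ x y (fun a b => m (a \ b) = 0) fun a b a' b' h1 h2 => by
    refine propext ⟨fun h => ?_, fun h => ?_⟩
    · exact m.null_sdiff_trans h1.2 (m.null_sdiff_trans h h2.1)
    · exact m.null_sdiff_trans h1.1 (m.null_sdiff_trans h h2.2)

theorem cls_le_cls {a b : B} : m.cls a ≤ m.cls b ↔ m (a \ b) = 0 := Iff.rfl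

theorem cls_mono {a b : B} (h : a ≤ b) : m.cls a ≤ m.cls b := by
  rw [cls_le_cls, sdiff_eq_bot_iff.2 h, m.bot']

instance : Max m.Quot where
  max x y := Quotient.liftOn₂ x y (fun a b => m.cls (a ⊔ b)) fun a b a' b' h1 h2 => by
    rw [cls_eq_iff]
    constructor
    · rw [sup_sdiff]
      exact m.null_sup (m.null_mono (sdiff_le_sdiff_left le_sup_left) h1.1)
        (m.null_mono (sdiff_le_sdiff_left le_sup_right) h2.1)
    · rw [sup_sdiff]
      exact m.null_sup (m.null_mono (sdiff_le_sdiff_left le_sup_left) h1.2)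
        (m.null_mono (sdiff_le_sdiff_left le_sup_right) h2.2)

instance : Compl m.Quot where
  compl x := Quotient.liftOn x (fun a => m.cls aᶜ) fun a b h => by
    rw [cls_eq_iff]
    simpa only [compl_sdiff_compl] using And.symm h

instance : Min m.Quot where
  min x y := (xᶜ ⊔ yᶜ)ᶜ

instance : Top m.Quot := ⟨m.cls ⊤⟩

instance : Bot m.Quot := ⟨m.cls ⊥⟩

theorem cls_inf (a b : B) : m.cls (a ⊓ b) = m.cls a ⊓ m.cls b := by
  change m.cls (a ⊓ b) = m.cls (aᶜ ⊔ bᶜ)ᶜ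
  rw [compl_sup, compl_compl, compl_compl]

theorem cls_sup (a b : B) : m.cls (a ⊔ b) = m.cls a ⊔ m.cls b := rfl

theorem cls_compl (a : B) : m.cls aᶜ = (m.cls a)ᶜ := rfl

instance instBooleanAlgebraQuot : BooleanAlgebra m.Quot where
  le_refl x := by
    obtain ⟨a, rfl⟩ := m.cls_surjective x
    exact m.cls_mono le_rfl
  le_trans x y z := by
    obtain ⟨a, rfl⟩ := m.cls_surjective x
    obtain ⟨b, rfl⟩ := m.cls_surjective y
    obtain ⟨c, rfl⟩ := m.cls_surjective z
    exact m.null_sdiff_trans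
  le_antisymm x y := by
    obtain ⟨a, rfl⟩ := m.cls_surjective x
    obtain ⟨b, rfl⟩ := m.cls_surjective y
    exact fun h1 h2 => m.cls_eq_iff.2 ⟨h1, h2⟩
  sup := max
  le_sup_left x y := by
    obtain ⟨a, rfl⟩ := m.cls_surjective x
    obtain ⟨b, rfl⟩ := m.cls_surjective y
    exact m.cls_mono le_sup_left
  le_sup_right x y := by
    obtain ⟨a, rfl⟩ := m.cls_surjective x
    obtain ⟨b, rfl⟩ := m.cls_surjective y
    exact m.cls_mono le_sup_right
  sup_le x y z := by
    obtain ⟨a, rfl⟩ := m.cls_surjective x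
    obtain ⟨b, rfl⟩ := m.cls_surjective y
    obtain ⟨c, rfl⟩ := m.cls_surjective z
    intro h1 h2
    rw [← cls_sup, cls_le_cls, sup_sdiff]
    exact m.null_sup h1 h2
  inf := min
  inf_le_left x y := by
    obtain ⟨a, rfl⟩ := m.cls_surjective x
    obtain ⟨b, rfl⟩ := m.cls_surjective y
    rw [← cls_inf]
    exact m.cls_mono inf_le_left
  inf_le_right x y := by
    obtain ⟨a, rfl⟩ := m.cls_surjective x
    obtain ⟨b, rfl⟩ := m.cls_surjective y
    rw [← cls_inf]
    exact m.cls_mono inf_le_right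
  le_inf x y z := by
    obtain ⟨a, rfl⟩ := m.cls_surjective x
    obtain ⟨b, rfl⟩ := m.cls_surjective y
    obtain ⟨c, rfl⟩ := m.cls_surjective z
    intro h1 h2
    rw [← cls_inf, cls_le_cls, sdiff_inf]
    exact m.null_sup h1 h2
  le_sup_inf x y z := by
    obtain ⟨a, rfl⟩ := m.cls_surjective x
    obtain ⟨b, rfl⟩ := m.cls_surjective y
    obtain ⟨c, rfl⟩ := m.cls_surjective z
    rw [← cls_sup, ← cls_sup, ← cls_inf, ← cls_inf, ← cls_sup]
    exact m.cls_mono le_sup_inf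
  inf_compl_le_bot x := by
    obtain ⟨a, rfl⟩ := m.cls_surjective x
    rw [← cls_compl, ← cls_inf]
    exact m.cls_mono (inf_compl_self a).le
  top_le_sup_compl x := by
    obtain ⟨a, rfl⟩ := m.cls_surjective x
    rw [← cls_compl, ← cls_sup]
    exact m.cls_mono (sup_compl_eq_top).ge
  le_top x := by
    obtain ⟨a, rfl⟩ := m.cls_surjective x
    exact m.cls_mono le_top
  bot_le x := by
    obtain ⟨a, rfl⟩ := m.cls_surjective x
    exact m.cls_mono bot_le

theorem cls_isLUB {E : ℕ → B} {a : B} (h : IsLUB (range E) a) :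
    IsLUB (range fun n => m.cls (E n)) (m.cls a) := by
  constructor
  · rintro _ ⟨n, rfl⟩
    exact m.cls_mono (h.1 ⟨n, rfl⟩)
  · intro x hx
    obtain ⟨b, rfl⟩ := m.cls_surjective x
    rw [cls_le_cls, _root_.sdiff_eq]
    refine le_antisymm ((m.le_sum (isLUB_inf h bᶜ)).trans (le_of_eq ?_)) zero_le
    rw [ENNReal.tsum_eq_zero]
    intro n
    rw [← _root_.sdiff_eq]
    exact m.cls_le_cls.1 (hx ⟨n, rfl⟩)

/-- The quotient map as a morphism of `σ`-complete Boolean algebras. -/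
def clsHom : SigmaHom B m.Quot where
  toFun := m.cls
  map_sup' _ _ := rfl
  map_inf' := m.cls_inf
  map_top' := rfl
  map_bot' := rfl
  map_isLUB' _ _ h := m.cls_isLUB h

theorem cls_congr {a b : B} (h : m.cls a = m.cls b) : m a = m b := by
  have key : ∀ a b : B, m (a \ b) = 0 → m a ≤ m b := fun a b h =>
    (m.mono (le_sup_sdiff : a ≤ b ⊔ a \ b)).trans ((m.sup_le_add _ _).trans (by rw [h, add_zero]))
  have h' := m.cls_eq_iff.1 h
  exact le_antisymm (key _ _ h'.1) (key _ _ h'.2)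

variable [SigmaComplete B]

instance : SigmaComplete m.Quot where
  exists_isLUB E := by
    choose e he using fun n => m.cls_surjective (E n)
    obtain ⟨a, ha⟩ := SigmaComplete.exists_isLUB e
    refine ⟨m.cls a, ?_⟩
    have := m.cls_isLUB ha
    simpa only [he] using this

theorem exists_rep_isLUB {E : ℕ → m.Quot} {x : m.Quot} (h : IsLUB (range E) x) :
    ∃ (e : ℕ → B) (a : B), (∀ n, m.cls (e n) = E n) ∧ m.cls a = x ∧ IsLUB (range e) a := by
  choose e he using fun n => m.cls_surjective (E n)
  obtain ⟨a, ha⟩ := SigmaComplete.exists_isLUB e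
  refine ⟨e, a, he, ?_, ha⟩
  have := m.cls_isLUB ha
  simp only [he] at this
  exact this.unique h

/-- The descent of the measure to the quotient. -/
def quot : ProbMeas m.Quot where
  toFun x := Quotient.liftOn x (fun a => m a) fun _ _ h => m.cls_congr (Quotient.sound h)
  bot' := m.bot'
  top' := m.top'
  tsum' E x hE hx := by
    obtain ⟨e, a, he, rfl, ha⟩ := m.exists_rep_isLUB hx
    obtain rfl : (fun n => m.cls (e n)) = E := funext he
    change m a = ∑' n, m (e n)
    rw [m.tsum' _ _ (fun i j hij => disjoint_disjointed e hij) (isLUB_disjointed ha)]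
    congr 1
    ext n
    have hd : ∀ k < n, m (e n ⊓ e k) = 0 := by
      intro k hk
      have := disjoint_iff.1 (hE n k hk.ne')
      rw [← cls_inf] at this
      have h2 := m.cls_congr (this : _ = m.cls ⊥)
      rwa [m.bot'] at h2
    have hps : m (e n ⊓ (Finset.Iio n).sup e) = 0 := by
      refine Finset.sup_induction (p := fun x => m (e n ⊓ x) = 0) ?_ ?_ ?_
      · rw [inf_bot_eq, m.bot']
      · intro x hx y hy
        rw [inf_sup_left]
        exact m.null_sup hx hy
      · exact fun k hk => hd k (Finset.mem_Iio.1 hk)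
    refine m.cls_congr (m.cls_eq_iff.2 ⟨?_, ?_⟩)
    · rw [sdiff_eq_bot_iff.2 (disjointed_le e n), m.bot']
    · rwa [disjointed_apply, _root_.sdiff_sdiff_right_self]

theorem quot_cls (a : B) : m.quot (m.cls a) = m a := rfl

theorem quot_pos {x : m.Quot} (hx : x ≠ ⊥) : 0 < m.quot x := by
  obtain ⟨a, rfl⟩ := m.cls_surjective x
  rw [pos_iff_ne_zero]
  intro h
  refine hx (le_bot_iff.1 ?_)
  change m (a \ ⊥) = 0
  rwa [sdiff_bot]

end ProbMeas

/-! ### Abstract probability spaces and probability algebras -/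

/-- An abstract probability space: a `σ`-complete Boolean algebra with a probability measure. -/
structure AbsProb : Type (u + 1) where
  /-- The Boolean algebra of events. -/
  alg : Type u
  [instBA : BooleanAlgebra alg]
  [instSC : SigmaComplete alg]
  /-- The probability measure. -/
  meas : ProbMeas alg

attribute [instance] AbsProb.instBA AbsProb.instSC

/-- An abstract measure preserving map `X → Y`: a morphism of the algebras in the opposite
direction, along which the measure of `X` pulls back to the measure of `Y`. -/
@[ext]
structure AbsProb.Hom (X Y : AbsProb.{u}) : Type u where
  /-- The pullback of events. -/
  pullback : SigmaHom Y.alg X.alg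
  meas_pullback : ∀ E, X.meas (pullback E) = Y.meas E

instance : Category AbsProb.{u} where
  Hom := AbsProb.Hom
  id X := ⟨SigmaHom.id X.alg, fun _ => rfl⟩
  comp f g := ⟨f.pullback.comp g.pullback, fun E => by
    rw [SigmaHom.comp_apply, f.meas_pullback, g.meas_pullback]⟩

/-- A probability algebra: an abstract probability space in which only the bottom element has
measure zero. -/
structure ProbAlg : Type (u + 1) extends AbsProb.{u} where
  pos : ∀ E : alg, E ≠ ⊥ → 0 < meas E

/-- Morphisms of probability algebras are the abstract measure preserving maps. -/
instance : Category ProbAlg.{u} where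
  Hom X Y := AbsProb.Hom X.toAbsProb Y.toAbsProb
  id X := 𝟙 X.toAbsProb
  comp f g := CategoryStruct.comp (obj := AbsProb.{u}) f g

/-- The functor that deletes the null events: it sends an abstract probability space to the quotient
of its algebra by the null ideal, with the descended measure. -/
def Mes : AbsProb.{u} ⥤ ProbAlg.{u} where
  obj X :=
    { alg := X.meas.Quot
      meas := X.meas.quot
      pos := fun _ => X.meas.quot_pos }
  map {X Y} f :=
    { pullback :=
        { toFun := fun x => Quotient.liftOn x (fun a => X.meas.cls (f.pullback a)) fun a b h => by
            rw [X.meas.cls_eq_iff, ← map_sdiff', ← map_sdiff', f.meas_pullback, f.meas_pullback]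
            exact h
          map_sup' := fun x y => by
            obtain ⟨a, rfl⟩ := Y.meas.cls_surjective x
            obtain ⟨b, rfl⟩ := Y.meas.cls_surjective y
            change X.meas.cls (f.pullback (a ⊔ b)) = _
            rw [map_sup]
            rfl
          map_inf' := fun x y => by
            obtain ⟨a, rfl⟩ := Y.meas.cls_surjective x
            obtain ⟨b, rfl⟩ := Y.meas.cls_surjective y
            rw [← Y.meas.cls_inf]
            change X.meas.cls (f.pullback (a ⊓ b)) = _
            rw [map_inf, X.meas.cls_inf]
            rfl
          map_top' := congrArg X.meas.cls (map_top f.pullback)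
          map_bot' := congrArg X.meas.cls (BotHomClass.map_bot f.pullback)
          map_isLUB' := fun E x h => by
            obtain ⟨e, a, he, rfl, ha⟩ := Y.meas.exists_rep_isLUB h
            obtain rfl : (fun n => Y.meas.cls (e n)) = E := funext he
            exact X.meas.cls_isLUB (f.pullback.map_isLUB ha) }
      meas_pullback := fun x => by
        obtain ⟨a, rfl⟩ := Y.meas.cls_surjective x
        exact f.meas_pullback a }
  map_id X := by
    refine AbsProb.Hom.ext (SigmaHom.ext fun x => ?_)
    obtain ⟨a, rfl⟩ := X.meas.cls_surjective x
    rfl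
  map_comp {X Y Z} f g := by
    refine AbsProb.Hom.ext (SigmaHom.ext fun x => ?_)
    obtain ⟨a, rfl⟩ := Z.meas.cls_surjective x
    rfl

/-! ### Compact Hausdorff probability spaces -/

/-- The Baire `σ`-algebra of a (compact Hausdorff) space, generated by the continuous functions. -/
@[reducible] def baire (X : Type u) [TopologicalSpace X] : MeasurableSpace X :=
  ⨆ f : C(X, ℂ), MeasurableSpace.comap f inferInstance

theorem measurable_baire {X : Type u} [TopologicalSpace X] (f : C(X, ℂ)) :
    @Measurable _ _ (baire X) _ f :=
  Measurable.of_comap_le (le_iSup (fun f : C(X, ℂ) => MeasurableSpace.comap f inferInstance) f)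

theorem measurable_baire_of_continuous {X : Type u} {Y : Type v} [TopologicalSpace X]
    [TopologicalSpace Y] (T : C(X, Y)) : @Measurable _ _ (baire X) (baire Y) T := by
  rw [measurable_iff_comap_le]
  simp only [baire, MeasurableSpace.comap_iSup, MeasurableSpace.comap_comp]
  exact iSup_le fun f => le_iSup (fun f : C(X, ℂ) => MeasurableSpace.comap f inferInstance)
    (f.comp T)

theorem baire_le_borel (X : Type u) [TopologicalSpace X] : baire X ≤ borel X := by
  refine iSup_le fun f => ?_
  rw [← measurable_iff_comap_le]
  let _ : MeasurableSpace X := borel X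
  have : BorelSpace X := ⟨rfl⟩
  exact f.continuous.measurable

/-- A compact Hausdorff probability space: a compact Hausdorff space with a probability measure on
the Baire `σ`-algebra. (Such a measure is automatically inner regular with respect to compact `G_δ`
sets.) -/
structure CHProb : Type (u + 1) where
  /-- The underlying space. -/
  carrier : Type u
  [instTop : TopologicalSpace carrier]
  [instCompact : CompactSpace carrier]
  [instT2 : T2Space carrier]
  /-- The measure. -/
  meas : @Measure carrier (baire carrier)
  isProb : @IsProbabilityMeasure carrier (baire carrier) meas

namespace CHProb

attribute [instance] instTop instCompact instT2

instance (X : CHProb.{u}) : MeasurableSpace X.carrier := baire X.carrier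

instance (X : CHProb.{u}) : IsProbabilityMeasure X.meas := X.isProb

/-- Morphisms are continuous measure preserving maps. -/
@[ext]
structure Hom (X Y : CHProb.{u}) : Type u where
  /-- The underlying continuous map. -/
  toMap : C(X.carrier, Y.carrier)
  map_meas : X.meas.map toMap = Y.meas

theorem Hom.measurable {X Y : CHProb.{u}} (f : Hom X Y) : Measurable f.toMap :=
  measurable_baire_of_continuous f.toMap

instance : Category CHProb.{u} where
  Hom := Hom
  id X := ⟨ContinuousMap.id X.carrier, Measure.map_id⟩
  comp {X Y Z} f g := ⟨g.toMap.comp f.toMap, by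
    rw [ContinuousMap.coe_comp, ← Measure.map_map g.measurable f.measurable, f.map_meas,
      g.map_meas]⟩

end CHProb

/-- The probability measure on the algebra of measurable sets of a probability space. -/
def ProbMeas.ofMeasure {Z : Type u} [MeasurableSpace Z] (μ : Measure Z) [IsProbabilityMeasure μ] :
    ProbMeas (MSets Z) where
  toFun s := μ s
  bot' := measure_empty
  top' := measure_univ
  tsum' E a hE ha := by
    rw [(isLUB_mSets_iff E a).1 ha]
    refine measure_iUnion (fun i j hij => ?_) fun n => (E n).2
    have := disjoint_iff.1 (hE i j hij)
    exact Set.disjoint_iff_inter_eq_empty.2 (congrArg Subtype.val this)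

/-- The abstraction functor: a compact Hausdorff probability space is sent to its Baire algebra with
its measure, a continuous measure preserving map to the pullback of Baire sets. -/
def Abs : CHProb.{u} ⥤ AbsProb.{u} where
  obj X :=
    { alg := MSets X.carrier
      meas := ProbMeas.ofMeasure X.meas }
  map {X Y} f :=
    { pullback := preimageHom f.toMap f.measurable
      meas_pullback := fun E => by
        change X.meas (f.toMap ⁻¹' E) = Y.meas E
        rw [← f.map_meas, Measure.map_apply f.measurable E.2] }
  map_id _ := rfl
  map_comp _ _ := rfl

/-- The casting functor from compact Hausdorff probability spaces to probability algebras, sending a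
space to its Baire algebra modulo null sets. -/
def castProbAlg : CHProb.{u} ⥤ ProbAlg.{u} := Abs ⋙ Mes

/-! ### The trace and the functoriality of `L^∞` -/

section Law

variable {B : Type u} [BooleanAlgebra B] (m : ProbMeas B) {Z : Type v} [MeasurableSpace Z]
  {W : Type w} [MeasurableSpace W]

/-- The distribution of an abstractly measurable function. -/
def law (f : AbsFun Z B) : Measure Z :=
  Measure.ofMeasurable (fun s hs => m (f ⟨s, hs⟩))
    ((congrArg m (BotHomClass.map_bot f)).trans m.bot') fun E hE hd => by
      refine m.tsum' (fun n => f ⟨E n, hE n⟩) _ (fun i j hij => ?_)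
        (f.map_isLUB ((isLUB_mSets_iff (fun n => (⟨E n, hE n⟩ : MSets Z)) _).2 rfl))
      have h : (⟨E i, hE i⟩ : MSets Z) ⊓ ⟨E j, hE j⟩ = ⊥ :=
        Subtype.ext (Set.disjoint_iff_inter_eq_empty.1 (hd hij))
      rw [disjoint_iff, ← map_inf, h, BotHomClass.map_bot]

theorem law_apply (f : AbsFun Z B) {s : Set Z} (hs : MeasurableSet s) :
    law m f s = m (f ⟨s, hs⟩) := Measure.ofMeasurable_apply s hs

instance (f : AbsFun Z B) : IsProbabilityMeasure (law m f) :=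
  ⟨by rw [law_apply m f MeasurableSet.univ]; exact (congrArg m (map_top f)).trans m.top'⟩

theorem law_post (f : AbsFun Z B) {F : Z → W} (hF : Measurable F) :
    law m (f.post F hF) = (law m f).map F := by
  ext s hs
  rw [law_apply m _ hs, Measure.map_apply hF hs, law_apply m f (hF hs)]
  rfl

theorem law_ae_of_top (f : AbsFun Z B) {s : Set Z} (hs : MeasurableSet s) (h : f ⟨s, hs⟩ = ⊤) :
    ∀ᵐ z ∂law m f, z ∈ s := by
  have h1 : law m f s = 1 := by rw [law_apply m f hs, h, m.top']
  exact (mem_ae_iff_prob_eq_one hs).2 h1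

end Law

namespace Linf

section Trace

variable {B : Type u} [BooleanAlgebra B] (m : ProbMeas B)

theorem ae_norm_le (f : Linf B) : ∃ M : ℝ, ∀ᵐ z ∂law m f.toAbsFun, ‖z‖ ≤ M := by
  obtain ⟨M, hM⟩ := f.bounded
  exact ⟨M, law_ae_of_top m f.toAbsFun (disc M).2 hM⟩

theorem integrable_id (f : Linf B) : Integrable (fun z : ℂ => z) (law m f.toAbsFun) := by
  obtain ⟨M, hM⟩ := f.ae_norm_le m
  exact Integrable.of_bound measurable_id.aestronglyMeasurable M hM

/-- The integral of a bounded abstractly measurable function: the integral of the identity function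
of `ℂ` against its distribution. -/
def integral (f : Linf B) : ℂ := ∫ z, z ∂law m f.toAbsFun

theorem integral_of_eq_post {Z : Type v} [MeasurableSpace Z] {f : Linf B} {k : AbsFun Z B}
    {F : Z → ℂ} (hF : Measurable F) (h : f.toAbsFun = k.post F hF) :
    f.integral m = ∫ z, F z ∂law m k ∧ Integrable F (law m k) := by
  constructor
  · rw [integral, h, law_post]
    exact integral_map hF.aemeasurable measurable_id.aestronglyMeasurable
  · have h1 := f.integrable_id m
    rw [h, law_post] at h1
    exact (integrable_map_measure measurable_id.aestronglyMeasurable hF.aemeasurable).1 h1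

theorem integral_smul (c : ℂ) (f : Linf B) : (c • f).integral m = c * f.integral m := by
  rw [((integral_of_eq_post m (f := c • f) (k := f.toAbsFun) (measurable_const_mul c)) rfl).1,
    integral_const_mul]
  rfl

theorem integral_add [SigmaComplete B] (f g : Linf B) :
    (f + g).integral m = f.integral m + g.integral m := by
  have h1 := integral_of_eq_post m (f := f) measurable_fst
    (AbsFun.joint_fst f.toAbsFun g.toAbsFun).symm
  have h2 := integral_of_eq_post m (f := g) measurable_snd
    (AbsFun.joint_snd f.toAbsFun g.toAbsFun).symm
  have h3 := integral_of_eq_post m (f := f + g) (k := f.toAbsFun.joint g.toAbsFun)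
    (measurable_fst.add measurable_snd) rfl
  rw [h1.1, h2.1, h3.1]
  exact MeasureTheory.integral_add h1.2 h2.2

theorem integral_one : (1 : Linf B).integral m = 1 := by
  have h : ∀ᵐ z ∂law m (1 : Linf B).toAbsFun, z ∈ ({1} : Set ℂ) :=
    law_ae_of_top m _ (measurableSet_singleton 1) (if_pos rfl)
  rw [integral, integral_congr_ae (g := fun _ => (1 : ℂ)) h]
  simp

theorem star_mul_self_toAbsFun [SigmaComplete B] (f : Linf B) :
    (star f * f).toAbsFun = f.toAbsFun.post (fun z => star z * z)
      (Complex.continuous_conj.measurable.mul measurable_id) := by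
  have hj : (star f).toAbsFun.joint f.toAbsFun = f.toAbsFun.post (fun z => (star z, z))
      (Complex.continuous_conj.measurable.prodMk measurable_id) := AbsFun.joint_eq rfl rfl
  change AbsFun.post _ _ ((star f).toAbsFun.joint f.toAbsFun) = _
  rw [hj]
  rfl

theorem integral_star_mul_self [SigmaComplete B] (f : Linf B) :
    ∃ r : ℝ, 0 ≤ r ∧ (star f * f).integral m = r := by
  refine ⟨∫ z, ‖z‖ ^ 2 ∂law m f.toAbsFun, integral_nonneg fun z => sq_nonneg _, ?_⟩
  rw [(integral_of_eq_post m _ (star_mul_self_toAbsFun f)).1, ← integral_complex_ofReal]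
  congr 1
  ext z
  simpa using Complex.conj_mul' z

end Trace

section Map

variable {A : Type u} {B : Type v} [BooleanAlgebra A] [BooleanAlgebra B]

/-- Composition of a bounded abstractly measurable function with a morphism of algebras. -/
def mapFun (φ : SigmaHom A B) (f : Linf A) : Linf B where
  toAbsFun := φ.comp f.toAbsFun
  bounded := by
    obtain ⟨M, hM⟩ := f.bounded
    exact ⟨M, (congrArg φ hM).trans (map_top φ)⟩

theorem mapFun_const (φ : SigmaHom A B) (c : ℂ) : mapFun φ (const c) = const c := by
  refine Linf.ext (SigmaHom.ext fun s => ?_)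
  classical
  change φ (if c ∈ (s : Set ℂ) then ⊤ else ⊥) = if c ∈ (s : Set ℂ) then ⊤ else ⊥
  split_ifs
  · exact map_top φ
  · exact BotHomClass.map_bot φ

variable [SigmaComplete A] [SigmaComplete B]

theorem mapFun_op₂ (φ : SigmaHom A B) (ψ : ℂ × ℂ → ℂ) (hψ : Measurable ψ)
    (hb : ∀ M N : ℝ, ∃ K : ℝ, ∀ z w, ‖z‖ ≤ M → ‖w‖ ≤ N → ‖ψ (z, w)‖ ≤ K) (f g : Linf A) :
    mapFun φ (op₂ ψ hψ hb f g) = op₂ ψ hψ hb (mapFun φ f) (mapFun φ g) := by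
  have hj : (mapFun φ f).toAbsFun.joint (mapFun φ g).toAbsFun =
      φ.comp (f.toAbsFun.joint g.toAbsFun) :=
    AbsFun.joint_eq (congrArg φ.comp (AbsFun.joint_fst f.toAbsFun g.toAbsFun))
      (congrArg φ.comp (AbsFun.joint_snd f.toAbsFun g.toAbsFun))
  refine Linf.ext ?_
  change _ = AbsFun.post ψ hψ ((mapFun φ f).toAbsFun.joint (mapFun φ g).toAbsFun)
  rw [hj]
  rfl

/-- The Koopman operator: the unital `*`-homomorphism of `L^∞` algebras induced by a morphism. -/
def map (φ : SigmaHom A B) : Linf A →⋆ₐ[ℂ] Linf B where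
  toFun := mapFun φ
  map_one' := mapFun_const φ 1
  map_zero' := mapFun_const φ 0
  map_mul' _ _ := mapFun_op₂ φ _ _ _ _ _
  map_add' _ _ := mapFun_op₂ φ _ _ _ _ _
  commutes' c := by
    rw [Algebra.algebraMap_eq_smul_one, Algebra.algebraMap_eq_smul_one]
    change c • mapFun φ (const 1) = c • const 1
    rw [mapFun_const]
  map_star' _ := rfl

theorem integral_map_of {m : ProbMeas A} {m' : ProbMeas B} {φ : SigmaHom A B}
    (h : ∀ E, m' (φ E) = m E) (f : Linf A) : (map φ f).integral m' = f.integral m := by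
  have : law m' (map φ f).toAbsFun = law m f.toAbsFun := by
    ext s hs
    rw [law_apply _ _ hs, law_apply _ _ hs]
    exact h _
  rw [integral, this, integral]

end Map

end Linf

/-! ### Commutative `C⋆`-algebras with a trace -/

/-- A unital commutative `C⋆`-algebra with a state, that is a unital positive linear functional
(which is then automatically bounded, of norm one). -/
structure CStarTrace : Type (u + 1) where
  /-- The algebra. -/
  alg : Type u
  [instAlg : CommCStarAlgebra alg]
  /-- The state. -/
  tr : alg →ₗ[ℂ] ℂ
  tr_one : tr 1 = 1
  tr_nonneg : ∀ a, ∃ r : ℝ, 0 ≤ r ∧ tr (star a * a) = r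

attribute [instance] CStarTrace.instAlg

/-- Morphisms are the unital `*`-homomorphisms which preserve the states. -/
@[ext]
structure CStarTrace.Hom (A B : CStarTrace.{u}) : Type u where
  /-- The underlying homomorphism. -/
  toHom : A.alg →⋆ₐ[ℂ] B.alg
  tr_map : ∀ a, B.tr (toHom a) = A.tr a

instance : Category CStarTrace.{u} where
  Hom := CStarTrace.Hom
  id A := ⟨StarAlgHom.id ℂ A.alg, fun _ => rfl⟩
  comp f g := ⟨g.toHom.comp f.toHom, fun a => by
    rw [StarAlgHom.comp_apply, g.tr_map, f.tr_map]⟩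

/-- The functor `L^∞`, from probability algebras to (the opposite of) tracial commutative
`C⋆`-algebras. -/
def LinfFunctor : ProbAlg.{u} ⥤ CStarTrace.{u}ᵒᵖ where
  obj X := Opposite.op
    { alg := Linf X.alg
      tr :=
        { toFun := fun f => f.integral X.meas
          map_add' := Linf.integral_add X.meas
          map_smul' := Linf.integral_smul X.meas }
      tr_one := Linf.integral_one X.meas
      tr_nonneg := Linf.integral_star_mul_self X.meas }
  map T := Quiver.Hom.op
    (⟨Linf.map T.pullback, Linf.integral_map_of T.meas_pullback⟩ : CStarTrace.Hom _ _)
  map_id _ := rfl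
  map_comp _ _ := rfl

/-! ### Representation of states by Baire probability measures -/

section Riesz

variable {S : Type u} [TopologicalSpace S]

/-- Baire probability measures are determined by the integrals of continuous functions. -/
theorem baire_measure_ext [CompactSpace S] (μ ν : @Measure S (baire S))
    (hμ : @IsProbabilityMeasure S (baire S) μ) (hν : @IsProbabilityMeasure S (baire S) ν)
    (h : ∀ g : C(S, ℂ), @MeasureTheory.integral S ℂ _ _ (baire S) μ g =
      @MeasureTheory.integral S ℂ _ _ (baire S) ν g) : μ = ν := by
  let _ : MeasurableSpace S := baire S
  let Φ : S → C(S, ℂ) → ℂ := fun x f => f x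
  have hΦ : Measurable Φ := measurable_pi_iff.2 fun f => measurable_baire f
  have hfin : ∀ I : Finset C(S, ℂ), (μ.map Φ).map I.restrict = (ν.map Φ).map I.restrict := by
    intro I
    let R : C(S, I → ℂ) := ⟨fun x i => i.1 x, continuous_pi fun i => i.1.continuous⟩
    have hR : I.restrict ∘ Φ = R := rfl
    have hRm : Measurable R := measurable_pi_iff.2 fun i => measurable_baire i.1
    have hIr : Measurable (I.restrict : (C(S, ℂ) → ℂ) → _) := Finset.measurable_restrict I
    rw [Measure.map_map hIr hΦ, Measure.map_map hIr hΦ, hR]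
    have i1 : IsProbabilityMeasure (μ.map R) := Measure.isProbabilityMeasure_map hRm.aemeasurable
    have i2 : IsProbabilityMeasure (ν.map R) := Measure.isProbabilityMeasure_map hRm.aemeasurable
    refine ext_of_forall_integral_eq_of_IsFiniteMeasure fun g => ?_
    rw [integral_map hRm.aemeasurable g.continuous.measurable.aestronglyMeasurable,
      integral_map hRm.aemeasurable g.continuous.measurable.aestronglyMeasurable]
    have h1 := h ⟨fun x => ((g (R x) : ℝ) : ℂ), by fun_prop⟩
    simp only [ContinuousMap.coe_mk] at h1
    rw [integral_complex_ofReal, integral_complex_ofReal] at h1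
    exact_mod_cast h1
  have i1 : IsProbabilityMeasure (μ.map Φ) := Measure.isProbabilityMeasure_map hΦ.aemeasurable
  have i2 : IsProbabilityMeasure (ν.map Φ) := Measure.isProbabilityMeasure_map hΦ.aemeasurable
  have hmap : μ.map Φ = ν.map Φ :=
    IsProjectiveLimit.unique (P := fun I => (ν.map Φ).map I.restrict) hfin fun _ => rfl
  have hle : baire S ≤ MeasurableSpace.comap Φ inferInstance := by
    refine iSup_le fun f => ?_
    rintro _ ⟨t, ht, rfl⟩
    exact ⟨(fun p => p f) ⁻¹' t, measurable_pi_apply f ht, rfl⟩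
  ext s hs
  obtain ⟨t, ht, rfl⟩ := hle s hs
  rw [← Measure.map_apply hΦ ht, hmap, Measure.map_apply hΦ ht]

/-- A real continuous function as a complex one. -/
def toComplex (f : C(S, ℝ)) : C(S, ℂ) := ⟨fun x => (f x : ℂ), by fun_prop⟩

theorem exists_baire_measure [CompactSpace S] [T2Space S] (Λ : C(S, ℂ) →ₗ[ℂ] ℂ) (h1 : Λ 1 = 1)
    (hpos : ∀ g, ∃ r : ℝ, 0 ≤ r ∧ Λ (star g * g) = r) :
    ∃ μ : @Measure S (baire S), @IsProbabilityMeasure S (baire S) μ ∧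
      ∀ g : C(S, ℂ), @MeasureTheory.integral S ℂ _ _ (baire S) μ g = Λ g := by
  have hnn : ∀ f : C(S, ℝ), 0 ≤ f → ∃ r : ℝ, 0 ≤ r ∧ Λ (toComplex f) = r := by
    intro f hf
    have he : toComplex f = star (toComplex ⟨fun x => √(f x), by fun_prop⟩) *
        toComplex ⟨fun x => √(f x), by fun_prop⟩ := by
      ext x
      change (f x : ℂ) = star ((√(f x) : ℝ) : ℂ) * ((√(f x) : ℝ) : ℂ)
      rw [Complex.star_def, Complex.conj_ofReal, ← Complex.ofReal_mul,
        Real.mul_self_sqrt (show 0 ≤ f x from hf x)]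
    rw [he]
    exact hpos _
  have hreal : ∀ f : C(S, ℝ), Λ (toComplex f) = ((Λ (toComplex f)).re : ℂ) := by
    intro f
    obtain ⟨r, -, hr⟩ := hnn (f + ContinuousMap.const S ‖f‖) fun x => by
      have := neg_le_of_abs_le (f.norm_coe_le_norm x)
      change 0 ≤ f x + ‖f‖
      linarith
    have he : toComplex (f + ContinuousMap.const S ‖f‖) = toComplex f + (‖f‖ : ℂ) • 1 := by
      ext x
      simp [toComplex]
    rw [he, map_add, map_smul, h1, smul_eq_mul, mul_one] at hr
    have : Λ (toComplex f) = ((r - ‖f‖ : ℝ) : ℂ) := by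
      rw [eq_sub_of_add_eq hr]
      push_cast
      rfl
    rw [this, Complex.ofReal_re]
  let Λr : CompactlySupportedContinuousMap S ℝ →ₗ[ℝ] ℝ :=
    { toFun := fun f => (Λ (toComplex f.toContinuousMap)).re
      map_add' := fun f g => by
        have : toComplex (f + g).toContinuousMap =
            toComplex f.toContinuousMap + toComplex g.toContinuousMap := by
          ext x
          simp [toComplex]
        rw [this, map_add, Complex.add_re]
      map_smul' := fun c f => by
        have : toComplex (c • f).toContinuousMap = (c : ℂ) • toComplex f.toContinuousMap := by
          ext x
          simp [toComplex]
        rw [this, map_smul]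
        simp }
  let Λp : CompactlySupportedContinuousMap S ℝ →ₚ[ℝ] ℝ := PositiveLinearMap.mk₀ Λr fun f hf => by
    obtain ⟨r, hr, h⟩ := hnn f.toContinuousMap fun x => hf x
    change 0 ≤ (Λ (toComplex f.toContinuousMap)).re
    rw [h]
    exact hr
  let mB : MeasurableSpace S := borel S
  have hB : BorelSpace S := ⟨rfl⟩
  let μ : @Measure S mB := RealRMK.rieszMeasure Λp
  have hrint : ∀ f : C(S, ℝ), ∫ x, f x ∂μ = (Λ (toComplex f)).re := fun f =>
    RealRMK.integral_rieszMeasure Λp ⟨f, HasCompactSupport.of_compactSpace f⟩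
  have hint : ∀ g : C(S, ℂ), ∫ x, g x ∂μ = Λ g := by
    intro g
    let gr : C(S, ℝ) := ⟨fun x => (g x).re, by fun_prop⟩
    let gi : C(S, ℝ) := ⟨fun x => (g x).im, by fun_prop⟩
    have hg : g = toComplex gr + Complex.I • toComplex gi := by
      ext x
      change g x = ((g x).re : ℂ) + Complex.I * ((g x).im : ℂ)
      rw [mul_comm, Complex.re_add_im]
    have hgi : Integrable g μ := by
      refine Integrable.of_bound g.continuous.measurable.aestronglyMeasurable ‖g‖ ?_
      exact Filter.Eventually.of_forall g.norm_coe_le_norm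
    have h2 := integral_re_add_im hgi
    have e1 : ∫ x, RCLike.re (g x) ∂μ = (Λ (toComplex gr)).re := hrint gr
    have e2 : ∫ x, RCLike.im (g x) ∂μ = (Λ (toComplex gi)).re := hrint gi
    rw [← h2, e1, e2]
    conv_rhs => rw [hg, map_add, map_smul, hreal gr, hreal gi]
    simp [mul_comm]
  refine ⟨μ.trim (baire_le_borel S), ⟨?_⟩, fun g => ?_⟩
  · rw [trim_measurableSet_eq _ MeasurableSet.univ]
    have h3 : ∫ _, (1 : ℝ) ∂μ = 1 := by
      have := hrint 1
      have e : toComplex (1 : C(S, ℝ)) = 1 := by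
        ext x
        simp [toComplex]
      rw [e, h1] at this
      simpa using this
    rw [integral_const, smul_eq_mul, mul_one] at h3
    exact (ENNReal.toReal_eq_one_iff _).1 h3
  · rw [← integral_trim (baire_le_borel S)]
    · exact hint g
    · let _ : MeasurableSpace S := baire S
      exact (measurable_baire g).stronglyMeasurable


open WeakDual in
theorem existsUnique_spectralMeasure (A : CStarTrace.{u}) :
    ∃! μ : @Measure (characterSpace ℂ A.alg) (baire _),
      @IsProbabilityMeasure _ (baire _) μ ∧
      ∀ a : A.alg, @MeasureTheory.integral _ ℂ _ _ (baire _) μ (gelfandStarTransform A.alg a) =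
        A.tr a := by
  let e := gelfandStarTransform A.alg
  obtain ⟨μ, hμ, h⟩ := exists_baire_measure
    (A.tr.comp (e.symm.toAlgEquiv.toLinearEquiv.toLinearMap))
    (by
      change A.tr (e.symm 1) = 1
      rw [map_one, A.tr_one])
    (fun g => by
      obtain ⟨r, hr, h⟩ := A.tr_nonneg (e.symm g)
      refine ⟨r, hr, ?_⟩
      change A.tr (e.symm (star g * g)) = r
      rw [map_mul, map_star, h])
  have h' : ∀ a, @MeasureTheory.integral _ ℂ _ _ (baire _) μ (e a) = A.tr a := fun a => by
    rw [h]
    change A.tr (e.symm (e a)) = A.tr a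
    rw [StarAlgEquiv.symm_apply_apply]
  refine ⟨μ, ⟨hμ, h'⟩, ?_⟩
  rintro ν ⟨hν, hν'⟩
  refine baire_measure_ext _ _ hν hμ fun g => ?_
  rw [← e.apply_symm_apply g, h', hν']

/-- The unique Baire probability measure on the Gelfand spectrum which represents the state, after
identifying the algebra with the continuous functions on its spectrum. -/
def spectralMeasure (A : CStarTrace.{u}) :
    @Measure (WeakDual.characterSpace ℂ A.alg) (baire _) :=
  (existsUnique_spectralMeasure A).choose

/-- The Gelfand spectrum with the representing measure. -/
def rieszObj (A : CStarTrace.{u}) : CHProb.{u} where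
  carrier := WeakDual.characterSpace ℂ A.alg
  meas := spectralMeasure A
  isProb := (existsUnique_spectralMeasure A).choose_spec.1.1

theorem integral_gelfand (A : CStarTrace.{u}) (a : A.alg) :
    ∫ x : (rieszObj A).carrier, gelfandStarTransform A.alg a x ∂(rieszObj A).meas = A.tr a :=
  (existsUnique_spectralMeasure A).choose_spec.1.2 a

/-- The Riesz duality functor: a tracial commutative `C⋆`-algebra is sent to its Gelfand spectrum
with the Baire probability measure that represents the state, and a morphism `Φ` to the map
`χ ↦ χ ∘ Φ`. -/
def Riesz : CStarTrace.{u}ᵒᵖ ⥤ CHProb.{u} where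
  obj A := rieszObj A.unop
  map {A B} Φ :=
    { toMap := WeakDual.CharacterSpace.compContinuousMap Φ.unop.toHom
      map_meas := by
        let T : C((rieszObj A.unop).carrier, (rieszObj B.unop).carrier) :=
          WeakDual.CharacterSpace.compContinuousMap Φ.unop.toHom
        have hT : Measurable T := measurable_baire_of_continuous T
        have hP : IsProbabilityMeasure ((rieszObj A.unop).meas.map T) :=
          Measure.isProbabilityMeasure_map hT.aemeasurable
        change (rieszObj A.unop).meas.map T = (rieszObj B.unop).meas
        refine (existsUnique_spectralMeasure B.unop).unique
          ⟨hP, fun b => ?_⟩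
          (existsUnique_spectralMeasure B.unop).choose_spec.1
        have hm : Measurable fun x : (rieszObj B.unop).carrier =>
            gelfandStarTransform B.unop.alg b x := measurable_baire _
        refine (integral_map hT.aemeasurable hm.aestronglyMeasurable).trans ?_
        refine Eq.trans ?_ (Φ.unop.tr_map b)
        exact integral_gelfand A.unop (Φ.unop.toHom b) }
  map_id A := CHProb.Hom.ext (WeakDual.CharacterSpace.compContinuousMap_id A.unop.alg)
  map_comp Φ Ψ := CHProb.Hom.ext
    (WeakDual.CharacterSpace.compContinuousMap_comp Φ.unop.toHom Ψ.unop.toHom)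

end Riesz

/-! ### The canonical model and the strong Lusin property -/

/-- The canonical model functor: the Gelfand spectrum of `L^∞`, with the Baire probability measure
that represents the integral. -/
def Stone : ProbAlg.{u} ⥤ CHProb.{u} := LinfFunctor ⋙ Riesz

/-- The strong Lusin property: every class in `L^∞` contains exactly one continuous function. -/
def StrongLusin (X : CHProb.{u}) : Prop :=
  ∀ f : Lp ℂ ∞ X.meas, ∃! g : C(X.carrier, ℂ), f =ᵐ[X.meas] g

end CanonicalModel

end

noncomputable section

namespace CanonicalModel

open Set MeasureTheory CategoryTheory
open scoped ENNReal

/-! ### Measure preserving homomorphisms -/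

/-! Everything rests on one measure preserving isomorphism, `eventHom X`, between the algebra of `X`
and the Baire measure algebra of its canonical model. The indicator `ind E` of an event is an
idempotent of `L^∞(X)`, so its Gelfand transform takes only the values 0 and 1, and its level set at
1 is a clopen Baire set `event E`. Finite Boolean operations on events become the same operations on
sets, and the measure of `event E` is the integral of `ind E`, which is the measure of `E`. Passing
to classes modulo null sets gives a measure preserving Boolean homomorphism between probability
algebras. Such a map is injective, and by `SigmaHom.ofMeasurePreserving` it respects countable joins
as well.

Surjectivity comes from `eventHom_comp`: for `f` in `L^∞(X)` and a Borel set `s`, the class of the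
set where the transform of `f` lies in `s` is the image of the event `f(s)`. Every continuous
function on the spectrum is a Gelfand transform and the continuous functions generate the Baire
sets, so every class is attained. Naturality is the identity `event_pullback` of sets.

The other ingredient is full support, `eq_of_ae_eq`: the state on `L^∞(X)` is faithful, so
continuous functions that agree almost everywhere agree. Faithfulness of `Stone` follows formally
from the natural isomorphism. For fullness, the cast of a continuous map `S` equals the cast of
`Stone.map T` for some `T`. Casting is faithful on maps between canonical models, because continuous
functions see every point and full support removes the null sets, so `S` is `Stone.map T`.

For the strong Lusin property, an essentially bounded function determines a homomorphism from Borel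
sets to the measure algebra. Carried back by the inverse of `eventHom X`, it becomes an element of
`L^∞(X)`, and the Gelfand transform of that element is the continuous representative. Full support
gives its uniqueness and also the equality of the supremum and essential supremum norms. -/

/-- A measure preserving Boolean homomorphism into a probability algebra preserves countable
joins. -/
def SigmaHom.ofMeasurePreserving {A : Type u} {B : Type v} [BooleanAlgebra A] [BooleanAlgebra B]
    [SigmaComplete B] (m : ProbMeas A) (m' : ProbMeas B) (pos : ∀ b, m' b = 0 → b = ⊥)
    (φ : BoundedLatticeHom A B) (h : ∀ a, m' (φ a) = m a) : SigmaHom A B where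
  toBoundedLatticeHom := φ
  map_isLUB' E a ha := by
    change IsLUB (range fun n => φ (E n)) (φ a)
    -- Let `c` be the join of the images of the disjoint pieces. It lies below `φ a`, and countable
    -- additivity on both sides gives it the same measure, so the difference is null and therefore
    -- `⊥`.
    obtain ⟨c, hc⟩ := SigmaComplete.exists_isLUB fun n => φ (disjointed E n)
    have hca : c ≤ φ a := hc.2 <| by
      rintro _ ⟨n, rfl⟩
      exact OrderHomClass.mono φ ((disjointed_le E n).trans (ha.1 ⟨n, rfl⟩))
    have hmc : m' c = m' (φ a) := by
      rw [m'.tsum' _ _ (fun i j hij => ?_) hc, h, m.tsum' _ _ (fun i j hij => ?_)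
        (isLUB_disjointed ha)]
      · simp only [h]
      · exact disjoint_disjointed E hij
      · have := disjoint_iff.1 (disjoint_disjointed E hij)
        rw [disjoint_iff, ← map_inf]
        exact (congrArg φ this).trans (BotHomClass.map_bot φ)
    have hsd : m' (φ a \ c) = 0 := by
      have h1 := m'.sup_of_disjoint (disjoint_sdiff_self_right (x := c) (y := φ a))
      rw [sup_sdiff_cancel_right hca, ← hmc] at h1
      have hfin : m' c ≠ ∞ := ne_top_of_le_ne_top ENNReal.one_ne_top
        ((m'.mono le_top).trans m'.top'.le)
      exact (ENNReal.add_right_inj hfin).1 (by rw [add_zero, ← h1])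
    have hac : φ a = c := le_antisymm (sdiff_eq_bot_iff.1 (pos _ hsd)) hca
    constructor
    · rintro _ ⟨n, rfl⟩
      exact OrderHomClass.mono φ (ha.1 ⟨n, rfl⟩)
    · intro b hb
      rw [hac]
      refine hc.2 ?_
      rintro _ ⟨n, rfl⟩
      exact (OrderHomClass.mono φ (disjointed_le E n)).trans (hb ⟨n, rfl⟩)

theorem ProbAlg.eq_bot_of_meas_eq_zero (X : ProbAlg.{u}) (b : X.alg) (h : X.meas b = 0) :
    b = ⊥ := by
  by_contra hb
  exact (X.pos b hb).ne' h

/-- The inverse of a bijective morphism. -/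
def SigmaHom.inverse {A : Type u} {B : Type v} [BooleanAlgebra A] [BooleanAlgebra B]
    (φ : SigmaHom A B) (hφ : Function.Bijective φ) : SigmaHom B A :=
  -- The order is expressed by meets, so a bijective lattice homomorphism is an order isomorphism.
  -- Its inverse then preserves all existing joins.
  have hle : ∀ a b, φ a ≤ φ b ↔ a ≤ b := fun a b => by
    rw [← inf_eq_left, ← map_inf, hφ.1.eq_iff, inf_eq_left]
  let e : A ≃o B := { Equiv.ofBijective φ hφ with map_rel_iff' := hle _ _ }
  { toFun := e.symm
    map_sup' := map_sup e.symm
    map_inf' := map_inf e.symm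
    map_top' := map_top e.symm
    map_bot' := BotHomClass.map_bot e.symm
    map_isLUB' := fun E a h => by
      have := (e.symm.isLUB_image' (s := range E) (x := a)).2 h
      rwa [← range_comp] at this }

theorem SigmaHom.apply_inverse {A : Type u} {B : Type v} [BooleanAlgebra A] [BooleanAlgebra B]
    (φ : SigmaHom A B) (hφ : Function.Bijective φ) (b : B) : φ (φ.inverse hφ b) = b :=
  (Equiv.ofBijective φ hφ).apply_symm_apply b

theorem SigmaHom.inverse_apply {A : Type u} {B : Type v} [BooleanAlgebra A] [BooleanAlgebra B]
    (φ : SigmaHom A B) (hφ : Function.Bijective φ) (a : A) : φ.inverse hφ (φ a) = a :=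
  (Equiv.ofBijective φ hφ).symm_apply_apply a

/-- A measure preserving bijective morphism of algebras is an isomorphism of probability
algebras. -/
def ProbAlg.isoOfBijective {X Y : ProbAlg.{u}} (φ : SigmaHom Y.alg X.alg)
    (h : ∀ E, X.meas (φ E) = Y.meas E) (hφ : Function.Bijective φ) : X ≅ Y where
  hom := (⟨φ, h⟩ : AbsProb.Hom _ _)
  inv := (⟨φ.inverse hφ, fun E => by rw [← h, φ.apply_inverse]⟩ : AbsProb.Hom _ _)
  hom_inv_id := AbsProb.Hom.ext (SigmaHom.ext fun E => φ.apply_inverse hφ E)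
  inv_hom_id := AbsProb.Hom.ext (SigmaHom.ext fun E => φ.inverse_apply hφ E)

/-! ### Indicator functions in `L^∞` -/

namespace Linf

section Ind

variable {B : Type u} [BooleanAlgebra B] [SigmaComplete B]

/-- The restriction of a bounded measurable function to a measurable set. -/
def restrict (S : MSets (Pts B)) (F : BMeas B) : BMeas B :=
  ⟨(S : Set (Pts B)).indicator F.1, F.2.1.indicator S.2, by
    obtain ⟨M, hM⟩ := F.2.2
    exact ⟨M, fun ω => (norm_indicator_le_norm_self _ _).trans (hM ω)⟩⟩

theorem restrict_apply_mem {S : MSets (Pts B)} (F : BMeas B) {ω : Pts B} (h : ω ∈ (S : Set _)) :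
    (restrict S F).1 ω = F.1 ω := indicator_of_mem h _

theorem restrict_apply_notMem {S : MSets (Pts B)} (F : BMeas B) {ω : Pts B}
    (h : ω ∉ (S : Set _)) : (restrict S F).1 ω = 0 := indicator_of_notMem h _

/-- The indicator function of an event. -/
def ind (E : B) : Linf B := q (restrict (present_surjective E).choose 1)

-- The preimage of `s` is empty, `S`, its complement or everything, according to which of 1 and 0
-- lie in `s`. The right side depends on `S` only through `present B S`, so the choice of
-- representative made in `ind` is immaterial.
open Classical in
theorem q_restrict_one_apply (S : MSets (Pts B)) (s : MSets ℂ) :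
    (q (restrict S 1)).toAbsFun s = (if (1 : ℂ) ∈ (s : Set ℂ) then present B S else ⊥) ⊔
      (if (0 : ℂ) ∈ (s : Set ℂ) then (present B S)ᶜ else ⊥) := by
  have key : preimageHom (restrict S 1).1 (restrict S 1).2.1 s =
      (if (1 : ℂ) ∈ (s : Set ℂ) then S else ⊥) ⊔ (if (0 : ℂ) ∈ (s : Set ℂ) then Sᶜ else ⊥) := by
    refine Subtype.ext (Set.ext fun ω => ?_)
    change (restrict S 1).1 ω ∈ (s : Set ℂ) ↔ _
    by_cases h : ω ∈ (S : Set (Pts B))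
    · rw [restrict_apply_mem _ h]
      change (1 : ℂ) ∈ (s : Set ℂ) ↔ _
      have h' : ω ∉ ((Sᶜ : MSets (Pts B)) : Set (Pts B)) := fun h2 => h2 h
      have h0 : ω ∉ ((⊥ : MSets (Pts B)) : Set (Pts B)) := fun h => h
      by_cases h1 : (1 : ℂ) ∈ (s : Set ℂ) <;> by_cases h2 : (0 : ℂ) ∈ (s : Set ℂ) <;>
        simp only [h1, h2, if_true, if_false, true_iff, false_iff]
      · exact Or.inl h
      · exact Or.inl h
      · exact fun hh => hh.elim h0 h'
      · exact fun hh => hh.elim h0 h0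
    · rw [restrict_apply_notMem _ h]
      have h' : ω ∈ ((Sᶜ : MSets (Pts B)) : Set (Pts B)) := h
      have h0 : ω ∉ ((⊥ : MSets (Pts B)) : Set (Pts B)) := fun h => h
      by_cases h1 : (1 : ℂ) ∈ (s : Set ℂ) <;> by_cases h2 : (0 : ℂ) ∈ (s : Set ℂ) <;>
        simp only [h1, h2, if_true, if_false, true_iff, false_iff]
      · exact Or.inr h'
      · exact fun hh => hh.elim h h0
      · exact Or.inr h'
      · exact fun hh => hh.elim h0 h0
  refine (congrArg (present B) key).trans ?_
  rw [map_sup]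
  split_ifs <;> simp only [map_compl', BotHomClass.map_bot]

open Classical in
theorem ind_apply (E : B) (s : MSets ℂ) :
    (ind E).toAbsFun s = (if (1 : ℂ) ∈ (s : Set ℂ) then E else ⊥) ⊔
      (if (0 : ℂ) ∈ (s : Set ℂ) then Eᶜ else ⊥) := by
  rw [ind, q_restrict_one_apply, (present_surjective E).choose_spec]

/-- With an arbitrary representative allowed, identities between indicators reduce to pointwise
identities of functions on `Pts B`. -/
theorem ind_present (S : MSets (Pts B)) : ind (present B S) = q (restrict S 1) :=
  Linf.ext (SigmaHom.ext fun s => by rw [ind_apply, q_restrict_one_apply])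

theorem ind_top : ind (⊤ : B) = 1 := by
  have h : ind (⊤ : B) = q (restrict ⊤ 1) := by rw [← ind_present, map_top]
  rw [h, q_one]
  exact congrArg q (Subtype.ext (indicator_univ _))

theorem ind_inf (E F : B) : ind (E ⊓ F) = ind E * ind F := by
  obtain ⟨S, rfl⟩ := present_surjective E
  obtain ⟨T, rfl⟩ := present_surjective F
  rw [← map_inf, ind_present, ind_present, ind_present, q_mul]
  exact congrArg q (Subtype.ext inter_indicator_one)

theorem ind_add_ind_compl (E : B) : ind E + ind Eᶜ = 1 := by
  obtain ⟨S, rfl⟩ := present_surjective E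
  rw [← map_compl', ind_present, ind_present, q_add, q_one]
  exact congrArg q (Subtype.ext (indicator_self_add_compl _ _))

/-- The distribution of `ind E` is carried by the two points 1 and 0, with mass `m E` at 1, and on
these points the integrand `z` is the indicator of `{1}`. -/
theorem integral_ind (m : ProbMeas B) (E : B) : (ind E).integral m = ((m E).toReal : ℂ) := by
  have h01 : MeasurableSet ({1, 0} : Set ℂ) := (measurableSet_singleton 0).insert 1
  have hae : ∀ᵐ z ∂law m (ind E).toAbsFun, z ∈ ({1, 0} : Set ℂ) :=
    law_ae_of_top m _ h01 (by rw [ind_apply]; simp)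
  have h1 : law m (ind E).toAbsFun {1} = m E := by
    rw [law_apply _ _ (measurableSet_singleton 1), ind_apply]
    simp
  rw [integral, integral_congr_ae (g := ({1} : Set ℂ).indicator fun _ => (1 : ℂ)),
    integral_indicator_const _ (measurableSet_singleton 1), measureReal_def, h1]
  · simp
  · filter_upwards [hae] with z hz
    rcases hz with rfl | rfl <;> simp

theorem map_ind {A : Type v} [BooleanAlgebra A] [SigmaComplete A] (φ : SigmaHom A B) (E : A) :
    map φ (ind E) = ind (φ E) := by
  refine Linf.ext (SigmaHom.ext fun s => ?_)
  change φ ((ind E).toAbsFun s) = _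
  rw [ind_apply, ind_apply, map_sup]
  split_ifs <;> simp only [map_compl', BotHomClass.map_bot]

/-! ### Norm estimates on the level events of a function. -/

/-- On the event that `f` lies within `R` of `c`, the difference `f - c` is bounded by `R`. -/
theorem norm_sub_mul_ind_le (f : Linf B) (c : ℂ) {R : ℝ} (hR : 0 ≤ R) {s : Set ℂ}
    (hs : MeasurableSet s) (h : ∀ z ∈ s, ‖z - c‖ ≤ R) :
    ‖(f - c • 1) * ind (f.toAbsFun ⟨s, hs⟩)‖ ≤ R := by
  obtain ⟨F, rfl⟩ := q_surjective f
  have h1 : ind ((q F).toAbsFun ⟨s, hs⟩) = q (restrict (preimageHom F.1 F.2.1 ⟨s, hs⟩) 1) :=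
    ind_present _
  rw [h1, q_one, q_smul, q_sub, q_mul, norm_q_le_iff hR]
  refine SigmaHom.eq_top_mono _ (a := ⊤) (fun ω _ => ?_) (map_top _)
  change ‖(F.1 ω - c * 1) * (restrict (preimageHom F.1 F.2.1 ⟨s, hs⟩) 1).1 ω‖ ≤ R
  by_cases hω : ω ∈ ((preimageHom F.1 F.2.1 ⟨s, hs⟩ : MSets (Pts B)) : Set (Pts B))
  · rw [restrict_apply_mem _ hω]
    change ‖(F.1 ω - c * 1) * 1‖ ≤ R
    rw [mul_one, mul_one]
    exact h _ hω
  · rw [restrict_apply_notMem _ hω]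
    simpa using hR

/-- On the event that `f` is at distance at least `R` from `c`, the difference `f - c` has an
inverse bounded by `R⁻¹`. -/
theorem exists_inverse_on (f : Linf B) (c : ℂ) {R : ℝ} (hR : 0 < R) {s : Set ℂ}
    (hs : MeasurableSet s) (h : ∀ z ∈ s, R ≤ ‖z - c‖) :
    ∃ g : Linf B, ‖g‖ ≤ R⁻¹ ∧ g * (f - c • 1) = ind (f.toAbsFun ⟨s, hs⟩) := by
  obtain ⟨F, rfl⟩ := q_surjective f
  have h1 : ind ((q F).toAbsFun ⟨s, hs⟩) = q (restrict (preimageHom F.1 F.2.1 ⟨s, hs⟩) 1) :=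
    ind_present _
  have hb : ∀ ω, ‖(F.1 ⁻¹' s).indicator (fun ω => (F.1 ω - c)⁻¹) ω‖ ≤ R⁻¹ := fun ω => by
    by_cases hω : ω ∈ F.1 ⁻¹' s
    · rw [indicator_of_mem hω, norm_inv]
      exact inv_anti₀ hR (h _ hω)
    · rw [indicator_of_notMem hω, norm_zero]
      exact (inv_pos.2 hR).le
  -- The reciprocal of `F - c` is cut off to the set where `F` takes values in `s`; there `F - c`
  -- has modulus at least `R`.
  let G : BMeas B := ⟨(F.1 ⁻¹' s).indicator fun ω => (F.1 ω - c)⁻¹,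
    (F.2.1.sub_const c).inv.indicator (F.2.1 hs), R⁻¹, hb⟩
  refine ⟨q G, ?_, ?_⟩
  · rw [norm_q_le_iff (inv_pos.2 hR).le]
    exact SigmaHom.eq_top_mono _ (a := ⊤) (fun ω _ => hb ω) (map_top _)
  · rw [h1, q_one, q_smul, q_sub, q_mul]
    refine congrArg q (Subtype.ext (funext fun ω => ?_))
    change (F.1 ⁻¹' s).indicator (fun ω => (F.1 ω - c)⁻¹) ω * (F.1 ω - c * 1) =
      (F.1 ⁻¹' s).indicator 1 ω
    by_cases hω : ω ∈ F.1 ⁻¹' s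
    · rw [indicator_of_mem hω, indicator_of_mem hω, mul_one, Pi.one_apply]
      refine inv_mul_cancel₀ (norm_pos_iff.1 (hR.trans_le (h _ hω)))
    · rw [indicator_of_notMem hω, indicator_of_notMem hω, zero_mul]

/-- The integral is faithful on a probability algebra. -/
theorem eq_zero_of_integral_star_mul_self {m : ProbMeas B} (pos : ∀ b, m b = 0 → b = ⊥)
    (f : Linf B) (h : (star f * f).integral m = 0) : f = 0 := by
  rw [(integral_of_eq_post m _ (star_mul_self_toAbsFun f)).1] at h
  have h2 : ∫ z, ‖z‖ ^ 2 ∂law m f.toAbsFun = 0 := by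
    have : ((∫ z, ‖z‖ ^ 2 ∂law m f.toAbsFun : ℝ) : ℂ) = 0 := by
      rw [← h, ← integral_complex_ofReal]
      congr 1
      ext z
      simpa using (Complex.conj_mul' z).symm
    exact_mod_cast this
  have hint : Integrable (fun z : ℂ => ‖z‖ ^ 2) (law m f.toAbsFun) := by
    obtain ⟨M, hM⟩ := f.ae_norm_le m
    refine Integrable.of_bound (by fun_prop) (M ^ 2) ?_
    filter_upwards [hM] with z hz
    simpa using pow_le_pow_left₀ (norm_nonneg z) hz 2
  have h3 := (integral_eq_zero_iff_of_nonneg (fun z => sq_nonneg _) hint).1 h2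
  have h4 : law m f.toAbsFun {0}ᶜ = 0 := by
    have h5 : ∀ᵐ z ∂law m f.toAbsFun, z = 0 := by
      filter_upwards [h3] with z hz
      simpa using hz
    exact ae_iff.1 h5
  rw [law_apply _ _ (measurableSet_singleton 0).compl] at h4
  -- The law of `f` is concentrated at 0. Since null events are `⊥`, this null statement becomes the
  -- exact one that `f` sends `{0}` to `⊤`.
  have h5 := pos _ h4
  have h6 : f.toAbsFun ⟨{0}, measurableSet_singleton 0⟩ = ⊤ := by
    have : (⟨{0}ᶜ, (measurableSet_singleton 0).compl⟩ : MSets ℂ) =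
      ⟨{0}, measurableSet_singleton 0⟩ᶜ := rfl
    rwa [this, map_compl', compl_eq_bot] at h5
  rw [← norm_le_zero_iff, norm_le_iff le_rfl]
  exact SigmaHom.eq_top_mono _ (a := ⟨{0}, measurableSet_singleton 0⟩)
    (fun z hz => by rw [mem_singleton_iff.1 hz]; exact norm_zero.le) h6

end Ind

end Linf

/-! ### The Gelfand transform of the canonical model -/

namespace Stone

variable (X : ProbAlg.{u})

/-- The Gelfand transform identifies `L^∞` with the continuous functions on the canonical model. -/
def gelfand : Linf X.alg ≃⋆ₐ[ℂ] C((Stone.obj X).carrier, ℂ) := gelfandStarTransform (Linf X.alg)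

theorem norm_gelfand (f : Linf X.alg) : ‖gelfand X f‖ = ‖f‖ :=
  (AddMonoidHomClass.isometry_iff_norm (WeakDual.gelfandTransform ℂ (Linf X.alg))).1
    (gelfandTransform_isometry _) f

theorem integral_gelfand (f : Linf X.alg) :
    ∫ x, gelfand X f x ∂(Stone.obj X).meas = f.integral X.meas :=
  CanonicalModel.integral_gelfand (LinfFunctor.obj X).unop f

/-- A point `x` is a character of `L^∞(X)`, and both sides are its value at the function `f` pulled
back along `T`. -/
theorem gelfand_map {X Y : ProbAlg.{u}} (T : X ⟶ Y) (f : Linf Y.alg) (x : (Stone.obj X).carrier) :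
    gelfand X (Linf.map (AbsProb.Hom.pullback T) f) x = gelfand Y f ((Stone.map T).toMap x) := rfl

theorem measurable_continuousMap {K : CHProb.{u}} (g : C(K.carrier, ℂ)) : Measurable g :=
  measurable_baire g

theorem memLp_top {K : CHProb.{u}} (g : C(K.carrier, ℂ)) : MemLp g ∞ K.meas :=
  memLp_top_of_bound (measurable_continuousMap g).aestronglyMeasurable ‖g‖
    (Filter.Eventually.of_forall g.norm_coe_le_norm)

/-- The measure of the canonical model has full support. -/
theorem eq_of_ae_eq {g h : C((Stone.obj X).carrier, ℂ)} (hgh : g =ᵐ[(Stone.obj X).meas] h) :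
    g = h := by
  -- The transform is onto, so `g - h` comes from some `f`. Its vanishing almost everywhere makes
  -- the state zero at `star f * f`, and the state is faithful.
  obtain ⟨f, hf⟩ : ∃ f, gelfand X f = g - h := (gelfand X).surjective (g - h)
  have h0 : f = 0 := by
    refine Linf.eq_zero_of_integral_star_mul_self X.eq_bot_of_meas_eq_zero f ?_
    rw [← integral_gelfand, map_mul, map_star, hf]
    refine integral_eq_zero_of_ae ?_
    filter_upwards [hgh] with x hx
    simp [hx]
  rw [h0, map_zero] at hf
  exact (sub_eq_zero.1 hf.symm)

/-! ### Events as clopen Baire sets. -/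

variable {X}

/-- The indicator is idempotent, the transform is multiplicative, and the only idempotents of `ℂ`
are 0 and 1. -/
theorem gelfand_ind_eq (E : X.alg) (x : (Stone.obj X).carrier) :
    gelfand X (Linf.ind E) x = 0 ∨ gelfand X (Linf.ind E) x = 1 := by
  have h : gelfand X (Linf.ind E) x * gelfand X (Linf.ind E) x = gelfand X (Linf.ind E) x := by
    rw [← ContinuousMap.mul_apply, ← map_mul, ← Linf.ind_inf, inf_idem]
  exact IsIdempotentElem.iff_eq_zero_or_one.1 h

/-- The Baire set of the canonical model which represents an event. -/
def event (E : X.alg) : MSets (Stone.obj X).carrier :=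
  ⟨gelfand X (Linf.ind E) ⁻¹' {1}, measurable_continuousMap _ (measurableSet_singleton 1)⟩

theorem mem_event {E : X.alg} {x : (Stone.obj X).carrier} :
    x ∈ (event E : Set _) ↔ gelfand X (Linf.ind E) x = 1 := Iff.rfl

theorem notMem_event {E : X.alg} {x : (Stone.obj X).carrier} :
    x ∉ (event E : Set _) ↔ gelfand X (Linf.ind E) x = 0 := by
  rw [mem_event]
  rcases gelfand_ind_eq E x with h | h <;> simp [h]

/-- Products of indicators give meets, and the sum with the indicator of the complement being 1
gives complements. Hence finite operations are respected exactly, with no null sets involved. -/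
theorem event_inf (E F : X.alg) : event (E ⊓ F) = event E ⊓ event F := by
  refine Subtype.ext (Set.ext fun x => ?_)
  change _ ↔ x ∈ (event E : Set _) ∧ x ∈ (event F : Set _)
  rw [mem_event, mem_event, mem_event, Linf.ind_inf, map_mul, ContinuousMap.mul_apply]
  rcases gelfand_ind_eq E x with h | h <;> rcases gelfand_ind_eq F x with h' | h' <;> simp [h, h']

theorem event_compl (E : X.alg) : event Eᶜ = (event E)ᶜ := by
  refine Subtype.ext (Set.ext fun x => ?_)
  change _ ↔ ¬ x ∈ (event E : Set _)
  have h := congrArg (fun g => gelfand X g x) (Linf.ind_add_ind_compl E)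
  simp only [map_add, map_one, ContinuousMap.add_apply, ContinuousMap.one_apply] at h
  rw [mem_event, mem_event]
  rcases gelfand_ind_eq E x with h' | h' <;> rw [h'] at h <;> simp_all

theorem event_top : event (⊤ : X.alg) = ⊤ := by
  refine Subtype.ext (Set.ext fun x => ?_)
  change _ ↔ True
  rw [mem_event, Linf.ind_top, map_one]
  simp

theorem event_bot : event (⊥ : X.alg) = ⊥ := by
  rw [← compl_top, event_compl, event_top, compl_top]

theorem event_sup (E F : X.alg) : event (E ⊔ F) = event E ⊔ event F := by
  rw [← compl_compl (E ⊔ F), compl_sup, event_compl, event_inf, event_compl, event_compl,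
    compl_inf, compl_compl, compl_compl]

/-- Both numbers are the integral of `ind E`, computed once on the spectrum and once from the
distribution of `ind E`. -/
theorem meas_event (E : X.alg) : (Stone.obj X).meas (event E : Set _) = X.meas E := by
  have h := integral_gelfand X (Linf.ind E)
  have h1 : (fun x => gelfand X (Linf.ind E) x) =
      (event E : Set (Stone.obj X).carrier).indicator fun _ => (1 : ℂ) := by
    ext x
    by_cases hx : x ∈ (event E : Set _)
    · rw [indicator_of_mem hx]
      exact mem_event.1 hx
    · rw [indicator_of_notMem hx]
      exact notMem_event.1 hx
  rw [h1, integral_indicator_const _ (event E).2, Linf.integral_ind, measureReal_def] at h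
  have h2 : ((Stone.obj X).meas (event E : Set _)).toReal = (X.meas E).toReal := by
    simpa using h
  have hfin : X.meas E ≠ ∞ := ne_top_of_le_ne_top ENNReal.one_ne_top
    ((X.meas.mono le_top).trans X.meas.top'.le)
  exact (ENNReal.toReal_eq_toReal_iff' (measure_ne_top _ _) hfin).1 h2

/-! ### The homomorphism from events to the Baire measure algebra. -/

/-- The quotient map from Baire sets to the measure algebra. -/
def baireCls (K : CHProb.{u}) : SigmaHom (MSets K.carrier) (castProbAlg.obj K).alg :=
  (ProbMeas.ofMeasure K.meas).clsHom

theorem baireCls_surjective (K : CHProb.{u}) : Function.Surjective (baireCls K) :=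
  ProbMeas.cls_surjective _

theorem baireCls_le_iff {K : CHProb.{u}} {s t : MSets K.carrier} :
    baireCls K s ≤ baireCls K t ↔ K.meas ((s : Set K.carrier) \ t) = 0 := Iff.rfl

variable (X) in
/-- The measure preserving morphism that sends an event to the class of its representing Baire
set. -/
def eventHom : SigmaHom X.alg (castProbAlg.obj (Stone.obj X)).alg :=
  -- The set representing a countable join can be strictly larger than the union of the representing
  -- sets. Preservation of measure shows that the two differ by a null set.
  SigmaHom.ofMeasurePreserving X.meas (castProbAlg.obj (Stone.obj X)).meas
    (ProbAlg.eq_bot_of_meas_eq_zero _)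
    { toFun := fun E => baireCls _ (event E)
      map_sup' := fun E F => by rw [event_sup, map_sup]
      map_inf' := fun E F => by rw [event_inf, map_inf]
      map_top' := by rw [event_top, map_top]
      map_bot' := by rw [event_bot, BotHomClass.map_bot] }
    meas_event

theorem meas_eventHom (E : X.alg) :
    (castProbAlg.obj (Stone.obj X)).meas (eventHom X E) = X.meas E := meas_event E

/-- If two events have the same image, their differences go to `⊥`, so they have measure zero and
vanish in a probability algebra. -/
theorem eventHom_injective : Function.Injective (eventHom X) := by
  have hle : ∀ E F, eventHom X E = eventHom X F → E ≤ F := fun E F h => by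
    rw [← sdiff_eq_bot_iff]
    refine X.eq_bot_of_meas_eq_zero _ ?_
    have h0 : eventHom X (E \ F) = ⊥ := by
      rw [map_sdiff', h]
      exact sdiff_eq_bot_iff.2 le_rfl
    rw [← meas_eventHom, h0]
    exact (castProbAlg.obj (Stone.obj X)).meas.bot'
  exact fun E F h => le_antisymm (hle E F h) (hle F E h.symm)

/-! ### Level sets of the Gelfand transform -/

/-- Balls are convenient generators because membership in a ball or in its complement is an
inequality for `‖z - c‖`, which norms and inverses in `L^∞` detect. -/
theorem generateFrom_ball : (inferInstance : MeasurableSpace ℂ) =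
    MeasurableSpace.generateFrom {s | ∃ (c : ℂ) (r : ℝ), 0 < r ∧ s = Metric.ball c r} := by
  rw [BorelSpace.measurable_eq (α := ℂ)]
  refine TopologicalSpace.IsTopologicalBasis.borel_eq_generateFrom ?_
  refine TopologicalSpace.isTopologicalBasis_of_isOpen_of_nhds ?_ ?_
  · rintro _ ⟨c, r, -, rfl⟩
    exact Metric.isOpen_ball
  · intro a U ha hU
    obtain ⟨r, hr, h⟩ := Metric.isOpen_iff.1 hU a ha
    exact ⟨_, ⟨a, r, hr, rfl⟩, Metric.mem_ball_self hr, h⟩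

/-- Cutting `f - c` down to the event leaves an element of norm at most `R`. The transform is
isometric and multiplicative, and the transform of the indicator is 1 at `x`. -/
theorem event_subset_of_norm_sub_le (f : Linf X.alg) (c : ℂ) {R : ℝ} (hR : 0 ≤ R) {s : Set ℂ}
    (hs : MeasurableSet s) (h : ∀ z ∈ s, ‖z - c‖ ≤ R) {x : (Stone.obj X).carrier}
    (hx : x ∈ (event (f.toAbsFun ⟨s, hs⟩) : Set _)) : ‖gelfand X f x - c‖ ≤ R := by
  have h1 := Linf.norm_sub_mul_ind_le f c hR hs h
  rw [← norm_gelfand] at h1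
  have h2 := (ContinuousMap.norm_coe_le_norm _ x).trans h1
  rw [map_mul, ContinuousMap.mul_apply, mem_event.1 hx, mul_one, map_sub, map_smul, map_one] at h2
  simpa using h2

/-- At `x` the transform of `f - c` has an inverse of modulus at most `R⁻¹`, namely the value of the
transform of the partial inverse `g`. -/
theorem event_subset_of_le_norm_sub (f : Linf X.alg) (c : ℂ) {R : ℝ} (hR : 0 < R) {s : Set ℂ}
    (hs : MeasurableSet s) (h : ∀ z ∈ s, R ≤ ‖z - c‖) {x : (Stone.obj X).carrier}
    (hx : x ∈ (event (f.toAbsFun ⟨s, hs⟩) : Set _)) : R ≤ ‖gelfand X f x - c‖ := by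
  obtain ⟨g, hg, h1⟩ := Linf.exists_inverse_on f c hR hs h
  have h2 := congrArg (fun k => ‖gelfand X k x‖) h1
  simp only [map_mul, ContinuousMap.mul_apply, mem_event.1 hx, norm_mul, norm_one, map_sub,
    map_smul, map_one, ContinuousMap.sub_apply, ContinuousMap.smul_apply, ContinuousMap.one_apply,
    smul_eq_mul, mul_one] at h2
  rw [← norm_gelfand] at hg
  have h3 := ((gelfand X g).norm_coe_le_norm x).trans hg
  by_contra! hlt
  have h4 : ‖gelfand X g x‖ * ‖gelfand X f x - c‖ < R⁻¹ * R :=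
    mul_lt_mul' h3 hlt (norm_nonneg _) (inv_pos.2 hR)
  rw [h2, inv_mul_cancel₀ hR.ne'] at h4
  exact lt_irrefl _ h4

/-- The morphism of Borel sets into the measure algebra induced by a measurable function. -/
def preimageCls {K : CHProb.{u}} (g : K.carrier → ℂ) (hg : Measurable g) :
    AbsFun ℂ (castProbAlg.obj K).alg :=
  AbsFun.post g hg (baireCls K)

/-- The two estimates above carry only the closed conditions `≤ R` and `R ≤` over to the spectrum.
The complement of the ball is of this kind; the open ball has to be exhausted by closed balls, which
uses that `eventHom` respects countable joins. -/
theorem preimageCls_ball_eq (f : Linf X.alg) (c : ℂ) {r : ℝ} (hr : 0 < r)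
    (h : MeasurableSet (Metric.ball c r)) :
    eventHom X (f.toAbsFun ⟨Metric.ball c r, h⟩) =
      preimageCls (gelfand X f) (measurable_continuousMap _) ⟨Metric.ball c r, h⟩ := by
  let κ := baireCls (Stone.obj X)
  let pre := preimageHom (gelfand X f) (measurable_continuousMap _)
  have hcl : ∀ R, MeasurableSet (Metric.closedBall c R) := fun R => measurableSet_closedBall
  apply le_antisymm
  -- The radii `r - r / (n + 1)` start at 0 and increase to `r` without reaching it, so each is a
  -- legitimate nonnegative bound strictly below `r`.
  · have hU : Metric.ball c r = ⋃ n : ℕ, Metric.closedBall c (r - r / (n + 1)) := by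
      ext z
      simp only [Metric.mem_ball, mem_iUnion, Metric.mem_closedBall]
      constructor
      · intro hz
        obtain ⟨n, hn⟩ := exists_nat_one_div_lt (div_pos (sub_pos.2 hz) hr)
        refine ⟨n, ?_⟩
        rw [lt_div_iff₀ hr] at hn
        have : r / (n + 1) = 1 / ((n : ℝ) + 1) * r := by ring
        linarith
      · rintro ⟨n, hn⟩
        have : 0 < r / ((n : ℝ) + 1) := by positivity
        linarith
    have hl : IsLUB (range fun n : ℕ => (⟨_, hcl (r - r / (n + 1))⟩ : MSets ℂ))
        ⟨Metric.ball c r, h⟩ := (isLUB_mSets_iff _ _).2 hU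
    refine ((eventHom X).map_isLUB (f.toAbsFun.map_isLUB hl)).2 ?_
    rintro _ ⟨n, rfl⟩
    -- By definition `eventHom` is `κ` applied to `event`, so an honest inclusion of Baire sets is
    -- enough.
    refine OrderHomClass.mono κ (a := event _) (b := pre ⟨Metric.ball c r, h⟩) fun x hx => ?_
    change dist (gelfand X f x) c < r
    rw [dist_eq_norm]
    have h1 : 0 < r / ((n : ℝ) + 1) := by positivity
    have h2 : r / ((n : ℝ) + 1) ≤ r := div_le_self hr.le (by linarith [n.cast_nonneg (α := ℝ)])
    refine (event_subset_of_norm_sub_le f c (sub_nonneg.2 h2) (hcl _) (fun z hz => ?_) hx).trans_lt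
      (by linarith)
    rwa [Metric.mem_closedBall, dist_eq_norm] at hz
  -- After complementation, the bound `r ≤ ‖z - c‖` transfers directly and needs no approximation.
  · rw [← compl_le_compl_iff_le, ← map_compl', ← map_compl', ← map_compl']
    refine OrderHomClass.mono κ (a := event _) (b := pre ⟨Metric.ball c r, h⟩ᶜ) fun x hx => ?_
    change ¬ dist (gelfand X f x) c < r
    rw [dist_eq_norm, not_lt]
    refine event_subset_of_le_norm_sub f c hr h.compl (fun z hz => ?_) hx
    have hz' : ¬ dist z c < r := hz
    rwa [dist_eq_norm, not_lt] at hz'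

/-- The level sets of the Gelfand transform of `f` are represented by the values of `f`. -/
theorem eventHom_comp (f : Linf X.alg) :
    (eventHom X).comp f.toAbsFun = preimageCls (gelfand X f) (measurable_continuousMap _) := by
  refine mSets_hom_ext generateFrom_ball ?_
  rintro _ ⟨c, r, hr, rfl⟩ hm
  exact preimageCls_ball_eq f c hr hm

/-- The Baire sets whose class is attained form a `σ`-algebra, because `eventHom` and the quotient
map respect complements and countable joins. By `eventHom_comp` it contains the preimages of Borel
sets under all continuous functions, so it contains every Baire set. -/
theorem eventHom_surjective : Function.Surjective (eventHom X) := by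
  let 𝒮 : MeasurableSpace (Stone.obj X).carrier :=
    { MeasurableSet' := fun s => ∃ (hs : MeasurableSet s) (E : X.alg),
        eventHom X E = baireCls _ ⟨s, hs⟩
      measurableSet_empty := ⟨MeasurableSet.empty, ⊥,
        (BotHomClass.map_bot _).trans (BotHomClass.map_bot (baireCls _)).symm⟩
      measurableSet_compl := by
        rintro s ⟨hs, E, hE⟩
        refine ⟨hs.compl, Eᶜ, ?_⟩
        rw [map_compl', hE]
        exact (map_compl' (baireCls _) ⟨s, hs⟩).symm
      measurableSet_iUnion := by
        intro s h
        choose hs E hE using h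
        obtain ⟨a, ha⟩ := SigmaComplete.exists_isLUB E
        refine ⟨MeasurableSet.iUnion hs, a, ?_⟩
        have h1 := (eventHom X).map_isLUB ha
        have h2 := (baireCls _).map_isLUB ((isLUB_mSets_iff (fun n => ⟨s n, hs n⟩)
          ⟨_, MeasurableSet.iUnion hs⟩).2 rfl)
        simp only [hE] at h1
        exact h1.unique h2 }
  have hle : baire (Stone.obj X).carrier ≤ 𝒮 := by
    refine iSup_le fun g => ?_
    rintro _ ⟨s, hs, rfl⟩
    obtain ⟨f, hf⟩ : ∃ f, gelfand X f = g := (gelfand X).surjective g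
    have h := DFunLike.congr_fun (eventHom_comp f) ⟨s, hs⟩
    subst hf
    exact ⟨measurable_continuousMap _ hs, f.toAbsFun ⟨s, hs⟩, h⟩
  intro b
  obtain ⟨s, rfl⟩ := baireCls_surjective _ b
  exact (hle s.1 s.2).2

/-! ### The natural isomorphism -/

variable (X) in
/-- The canonical model of a probability algebra represents it. -/
def castIso : castProbAlg.obj (Stone.obj X) ≅ X :=
  ProbAlg.isoOfBijective (eventHom X) meas_eventHom ⟨eventHom_injective, eventHom_surjective⟩

/-- Naturality already holds for sets, before null sets are divided out: a morphism sends indicators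
to indicators, and the transform is natural. -/
theorem event_pullback {Y : ProbAlg.{u}} (T : X ⟶ Y) (E : Y.alg) :
    event (AbsProb.Hom.pullback T E) =
      preimageHom (Stone.map T).toMap (Stone.map T).measurable (event E) := by
  refine Subtype.ext (Set.ext fun x => ?_)
  change _ ↔ (Stone.map T).toMap x ∈ (event E : Set _)
  rw [mem_event, mem_event, ← gelfand_map, Linf.map_ind]

/-- Casting the canonical model is naturally isomorphic to the identity. -/
def castNatIso : Stone.{u} ⋙ castProbAlg.{u} ≅ 𝟭 ProbAlg.{u} :=
  NatIso.ofComponents castIso fun {X Y} T => by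
    refine AbsProb.Hom.ext (SigmaHom.ext fun E => ?_)
    change baireCls _ (preimageHom (Stone.map T).toMap (Stone.map T).measurable (event E)) =
      baireCls _ (event (AbsProb.Hom.pullback T E))
    rw [event_pullback]

/-! ### Almost everywhere equality -/

/-- For each Borel set `s`, almost every `x` with `g x ∈ s` has `h x ∈ s`. A countable base of `ℂ`
allows one null set for all basic open `s`, and some basic open set contains `g x` but not `h x`
whenever these differ. -/
theorem ae_eq_of_preimageCls_eq {K : CHProb.{u}} {g h : K.carrier → ℂ} (hg : Measurable g)
    (hh : Measurable h) (hgh : preimageCls g hg = preimageCls h hh) : g =ᵐ[K.meas] h := by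
  have key : ∀ s, MeasurableSet s → ∀ᵐ x ∂K.meas, g x ∈ s → h x ∈ s := fun s hs => by
    have h1 : K.meas (g ⁻¹' s \ h ⁻¹' s) = 0 :=
      (baireCls_le_iff (s := preimageHom g hg ⟨s, hs⟩) (t := preimageHom h hh ⟨s, hs⟩)).1
        (DFunLike.congr_fun hgh ⟨s, hs⟩).le
    filter_upwards [measure_eq_zero_iff_ae_notMem.1 h1] with x hx hgx
    by_contra hhx
    exact hx ⟨hgx, hhx⟩
  have hall : ∀ᵐ x ∂K.meas, ∀ s ∈ TopologicalSpace.countableBasis ℂ, g x ∈ s → h x ∈ s :=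
    (ae_ball_iff (TopologicalSpace.countable_countableBasis ℂ)).2 fun s hs =>
      key s (TopologicalSpace.isOpen_of_mem_countableBasis hs).measurableSet
  filter_upwards [hall] with x hx
  by_contra hne
  obtain ⟨s, hs, hgs, hsub⟩ := (TopologicalSpace.isBasis_countableBasis ℂ).exists_subset_of_mem_open
    (mem_compl_singleton_iff.2 hne) isOpen_compl_singleton
  exact hsub (hx s hs hgs) rfl

/-- Casting is faithful on maps between canonical models. -/
theorem eq_of_castProbAlg_map_eq {Y : ProbAlg.{u}} {S T : Stone.obj X ⟶ Stone.obj Y}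
    (h : castProbAlg.map S = castProbAlg.map T) : S = T := by
  refine CHProb.Hom.ext (ContinuousMap.ext fun x => ?_)
  -- Equal casts give equal classes for the preimages of every Baire set, so `g` composed with `S`
  -- and with `T` agree almost everywhere. Both are continuous, and full support makes them equal.
  have hcomp : ∀ g : C((Stone.obj Y).carrier, ℂ),
      g.comp (CHProb.Hom.toMap S) = g.comp (CHProb.Hom.toMap T) := fun g => by
    refine eq_of_ae_eq X (ae_eq_of_preimageCls_eq (measurable_continuousMap _)
      (measurable_continuousMap _) (SigmaHom.ext fun s => ?_))
    exact DFunLike.congr_fun (congrArg AbsProb.Hom.pullback h)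
      (baireCls _ (preimageHom g (measurable_continuousMap g) s))
  -- Points of the target are characters, and the transform of `f` evaluates them at `f`, so the
  -- continuous functions separate them.
  refine WeakDual.CharacterSpace.ext fun f => ?_
  exact DFunLike.congr_fun (hcomp (gelfand Y f)) x

/-- The composite with casting inherits fullness from the identity functor. This produces a `T`
whose canonical model map has the same cast as `S`, and casting is faithful on such maps. -/
theorem full : Stone.{u}.Full where
  map_surjective {X Y} S := by
    have := Functor.Full.of_iso (castNatIso.{u}).symm
    obtain ⟨T, hT⟩ := (Stone.{u} ⋙ castProbAlg.{u}).map_surjective (castProbAlg.map S)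
    exact ⟨T, eq_of_castProbAlg_map_eq hT⟩

theorem faithful : Stone.{u}.Faithful :=
  Functor.Faithful.of_comp_iso castNatIso.{u}

/-! ### The strong Lusin property -/

theorem ae_norm_le_of_memLp_top {Ω : Type*} [MeasurableSpace Ω] {μ : Measure Ω} {F : Ω → ℂ}
    (hF : MemLp F ∞ μ) : ∀ᵐ x ∂μ, ‖F x‖ ≤ (eLpNorm F ∞ μ).toReal := by
  filter_upwards [ae_le_eLpNormEssSup (f := F) (μ := μ)] with x hx
  rw [← toReal_enorm]
  exact ENNReal.toReal_mono hF.2.ne hx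

/-- Pulling Borel sets back along the function gives a homomorphism into the measure algebra. The
inverse of `eventHom` turns it into an element of `L^∞(X)`, and by `eventHom_comp` the transform of
that element induces the homomorphism one started from. -/
theorem exists_continuousMap_ae_eq {F : (Stone.obj X).carrier → ℂ}
    (hF : MemLp F ∞ (Stone.obj X).meas) :
    ∃ g : C((Stone.obj X).carrier, ℂ), F =ᵐ[(Stone.obj X).meas] g := by
  -- `F` is measurable only up to a null set, whereas preimages of Borel sets must be Baire sets;
  -- `G` is a genuinely measurable version.
  obtain ⟨G, hG, hFG⟩ := hF.1.aemeasurable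
  have hGm : MemLp G ∞ (Stone.obj X).meas := hF.ae_eq hFG
  have hM := ae_norm_le_of_memLp_top hGm
  set M := (eLpNorm G ∞ (Stone.obj X).meas).toReal
  have hbij : Function.Bijective (eventHom X) := ⟨eventHom_injective, eventHom_surjective⟩
  let f : Linf X.alg :=
    { toAbsFun := ((eventHom X).inverse hbij).comp (preimageCls G hG)
      bounded := by
        refine ⟨M, ?_⟩
        have : preimageCls G hG (disc M) = ⊤ := by
          rw [← top_le_iff, ← map_top (baireCls _)]
          refine baireCls_le_iff.2 (measure_mono_null (fun x hx => ?_) (ae_iff.1 hM))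
          exact hx.2
        exact (congrArg ((eventHom X).inverse hbij) this).trans (map_top _) }
  refine ⟨gelfand X f, hFG.trans (ae_eq_of_preimageCls_eq hG (measurable_continuousMap _) ?_)⟩
  rw [← eventHom_comp]
  exact SigmaHom.ext fun s => ((eventHom X).apply_inverse hbij _).symm

variable (X) in
theorem strongLusin : StrongLusin (Stone.obj X) := fun f => by
  obtain ⟨g, hg⟩ := exists_continuousMap_ae_eq (Lp.memLp f)
  exact ⟨g, hg, fun h hh => eq_of_ae_eq X (hh.symm.trans hg)⟩

/-- The essential supremum is clearly at most the supremum. For the converse, let `M` be the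
essential supremum: the continuous function `max ‖g‖ M` equals `M` almost everywhere, hence
everywhere by full support, so `‖g‖ ≤ M` at every point. -/
theorem norm_toLp (g : C((Stone.obj X).carrier, ℂ)) : ‖(memLp_top g).toLp g‖ = ‖g‖ := by
  rw [Lp.norm_toLp]
  refine le_antisymm (ENNReal.toReal_le_of_le_ofReal (norm_nonneg g) ?_) ?_
  · rw [eLpNorm_exponent_top]
    exact eLpNormEssSup_le_of_ae_bound (Filter.Eventually.of_forall g.norm_coe_le_norm)
  · set M := (eLpNorm g ∞ (Stone.obj X).meas).toReal
    let k : C((Stone.obj X).carrier, ℂ) := ⟨fun x => ((max ‖g x‖ M : ℝ) : ℂ), by fun_prop⟩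
    have hk : k = ContinuousMap.const _ (M : ℂ) := by
      refine eq_of_ae_eq X ?_
      filter_upwards [ae_norm_le_of_memLp_top (memLp_top g)] with x hx
      exact congrArg Complex.ofReal (max_eq_right hx)
    refine (ContinuousMap.norm_le _ ENNReal.toReal_nonneg).2 fun x => ?_
    have hx : ((max ‖g x‖ M : ℝ) : ℂ) = M := DFunLike.congr_fun hk x
    exact max_eq_right_iff.1 (Complex.ofReal_injective hx)

variable (X) in
/-- The continuous functions on the canonical model are its essentially bounded functions. -/
def continuousMapEquivLp :
    C((Stone.obj X).carrier, ℂ) ≃ₗᵢ[ℂ] Lp ℂ ∞ (Stone.obj X).meas :=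
  LinearIsometryEquiv.ofSurjective
    { toFun := fun g => (memLp_top g).toLp g
      map_add' := fun _ _ => rfl
      map_smul' := fun _ _ => rfl
      norm_map' := norm_toLp }
    -- Surjectivity is the existence half of the strong Lusin property.
    fun f => by
      obtain ⟨g, hg⟩ := exists_continuousMap_ae_eq (Lp.memLp f)
      exact ⟨g, Lp.ext ((memLp_top g).coeFn_toLp.trans hg.symm)⟩

end Stone

end CanonicalModel
end

open CanonicalModel CategoryTheory MeasureTheory
open scoped ENNReal

theorem proposition6p4 :
    (Nonempty (Stone.{u} ⋙ castProbAlg.{u} ≅ 𝟭 ProbAlg.{u}) ∧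
      Stone.{u}.Full ∧ Stone.{u}.Faithful) ∧
    (∀ X : ProbAlg.{u}, StrongLusin (Stone.{u}.obj X) ∧
      ∃ e : C((Stone.{u}.obj X).carrier, ℂ) ≃ₗᵢ[ℂ] Lp ℂ ∞ (Stone.{u}.obj X).meas,
        ∀ g : C((Stone.{u}.obj X).carrier, ℂ), e g =ᵐ[(Stone.{u}.obj X).meas] g) :=
  ⟨⟨⟨Stone.castNatIso⟩, Stone.full, Stone.faithful⟩, fun X => ⟨Stone.strongLusin X,
    Stone.continuousMapEquivLp X, fun g => (Stone.memLp_top g).coeFn_toLp⟩⟩
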